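/- Let $f\in\mathbb{R}(z)$ be a rational function of degree $2$ with real coefficients, regarded as a holomorphic self-map of the Riemann sphere $\hat{\mathbb{C}}=\mathbb{C}\cup\{\infty\}$. Suppose that $f$ lies in the escape locus, that is, there is an attracting fixed point $p\in\hat{\mathbb{C}}$ of $f$ (a fixed point whose multiplier has absolute value less than $1$) such that the orbit under $f$ of each critical point of $f$ converges to $p$. Then the Julia set $\mathcal{J}(f)\subset\hat{\mathbb{C}}$ (the complement of the largest open set on which the iterates of $f$ form a normal family) is either entirely contained in the real circle $\hat{\mathbb{R}}=\mathbb{R}\cup\{\infty\}$ or disjoint from it. -/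

import Mathlib

open Filter Topology

noncomputable section

namespace RatDyn

/-- The Riemann sphere `ℂ ∪ {∞}`. -/
abbrev Sphere : Type := OnePoint ℂ

/-- The unique uniform structure on the compact Hausdorff space `ℂ ∪ {∞}` (the one given by the
spherical metric); it induces the usual topology. -/
instance instUniformSpaceSphere : UniformSpace Sphere := uniformSpaceOfCompactR1

/-- The real circle `ℝ ∪ {∞}` inside the Riemann sphere. -/
def realCircle : Set Sphere :=
  insert OnePoint.infty (Set.range fun x : ℝ => (((x : ℂ) : Sphere)))

section RationalMaps

variable {K : Type*} [Field K] [Algebra K ℂ]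

/-- The degree of a rational map: the maximum of the degrees of numerator and denominator in
lowest terms. -/
def degree (f : RatFunc K) : ℕ := max f.num.natDegree f.denom.natDegree

open Classical in
/-- The self-map of the Riemann sphere induced by a rational function `f ∈ K(z)`, `K ⊆ ℂ`, written
in lowest terms as `p / q`. With `d = max (deg p) (deg q)`, the value at `∞` is the quotient of the
coefficients of `z ^ d` in `p` and in `q`. -/
def sphereMap (f : RatFunc K) : Sphere → Sphere
  | OnePoint.some z =>
      if Polynomial.aeval z f.denom = 0 then OnePoint.infty
      else ((Polynomial.aeval z f.num / Polynomial.aeval z f.denom : ℂ) : Sphere)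
  | OnePoint.infty =>
      if f.denom.coeff (degree f) = 0 then OnePoint.infty
      else ((algebraMap K ℂ (f.num.coeff (degree f)) /
        algebraMap K ℂ (f.denom.coeff (degree f)) : ℂ) : Sphere)

end RationalMaps

/-- The local coordinate near `a`: the identity if `a` is finite, and `z ↦ 1 / z` if `a = ∞`.
(It is only used near `a`; a value is assigned outside the chart domain to make it total.) -/
def coord : Sphere → Sphere → ℂ
  | OnePoint.some _, OnePoint.some w => w
  | OnePoint.some _, OnePoint.infty => 0
  | OnePoint.infty, OnePoint.some w => w⁻¹
  | OnePoint.infty, OnePoint.infty => 0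

open Classical in
/-- The local parametrisation at `a`, sending `0` to `a`: it is `z ↦ a + z` if `a` is finite, and
`z ↦ 1 / z` (with `0 ↦ ∞`) if `a = ∞`. -/
def param : Sphere → ℂ → Sphere
  | OnePoint.some a, z => ((a + z : ℂ) : Sphere)
  | OnePoint.infty, z => if z = 0 then OnePoint.infty else ((z⁻¹ : ℂ) : Sphere)

/-- The expression, as a complex function near `0`, of `F` in the local coordinates at `a` and at
`F a`. -/
def localExpr (F : Sphere → Sphere) (a : Sphere) : ℂ → ℂ :=
  fun z => coord (F a) (F (param a z))

/-- `c` is a critical point of `F`: the derivative of `F` at `c` in local coordinates vanishes. -/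
def IsCriticalPoint (F : Sphere → Sphere) (c : Sphere) : Prop :=
  HasDerivAt (localExpr F c) 0 0

/-- `p` is an attracting fixed point of `F`: it is fixed and its multiplier has absolute value
less than one (superattracting fixed points are included). -/
def IsAttractingFixedPoint (F : Sphere → Sphere) (p : Sphere) : Prop :=
  F p = p ∧ ∃ μ : ℂ, HasDerivAt (localExpr F p) μ 0 ∧ ‖μ‖ < 1

/-- A rational map is in the escape locus if all its critical orbits converge to one and the same
attracting fixed point. -/
def InEscapeLocus (F : Sphere → Sphere) : Prop :=
  ∃ p : Sphere, IsAttractingFixedPoint F p ∧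
    ∀ c : Sphere, IsCriticalPoint F c → Tendsto (fun n : ℕ => F^[n] c) atTop (𝓝 p)

/-- A family of maps is normal on `U` if every sequence in it has a subsequence that converges
locally uniformly on `U` for the spherical metric. -/
def IsNormalFamilyOn (𝓕 : Set (Sphere → Sphere)) (U : Set Sphere) : Prop :=
  ∀ s : ℕ → Sphere → Sphere, (∀ n, s n ∈ 𝓕) →
    ∃ φ : ℕ → ℕ, StrictMono φ ∧ ∃ g : Sphere → Sphere,
      TendstoLocallyUniformlyOn (fun n => s (φ n)) g atTop U

/-- The Fatou set: the points with an open neighbourhood on which the iterates form a normal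
family. -/
def fatouSet (F : Sphere → Sphere) : Set Sphere :=
  {z | ∃ U : Set Sphere, IsOpen U ∧ z ∈ U ∧ IsNormalFamilyOn (Set.range fun n : ℕ => F^[n]) U}

/-- The Julia set: the complement of the Fatou set. -/
def juliaSet (F : Sphere → Sphere) : Set Sphere := (fatouSet F)ᶜ

end RatDyn

end

noncomputable section

namespace RatDyn

/-! The basin of `p` lies in the Fatou set, so it suffices that this basin contains the real circle
or its complement (`BasinDichotomy`). Real coefficients make the critical set symmetric under
conjugation, which forces `p` to be real. A real Möbius map therefore moves `p` to `∞`, and a real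
affine change of coordinate leaves three normal forms: `z ^ 2 + c`, `A (z + 1 / z) + B` and `A (z -
1 / z) + B`, the last two with `1 < |A|` because the multiplier at `∞` is `1 / A`. In each case the
set `K` of finite nonescaping points is compact, and it must be shown to miss `ℝ` or to lie in it.

For `A (z - 1 / z) + B` the map expands `|im z|`, so the maximum of `|im z|` on `K` is zero. In the
other two cases suppose that `K` has a real point. Its extreme real points and the escape of the
critical points give an open interval `(s, t)` containing `K ∩ ℝ` and avoiding the critical value of
the relevant fold. The map is a fold (`z ^ 2` or `z + 1 / z`) followed by a real affine map. From a
nonreal `z`, the segment `[s, t]` is seen under a sum of two angles; after the fold the image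
segment is seen under their difference (`segForm_fold_le`). The affine preimage of `[s, t]` is
strictly shorter than that image segment (`segForm_lt_of_subset`). Hence the visual angle of `[s,
t]` strictly decreases along nonreal orbits in `K`, which compactness forbids
(`im_eq_zero_of_angle_decreasing`). -/

/-! ### Homogeneous coordinates on the Riemann sphere -/

open Classical in
/-- The point of the Riemann sphere with homogeneous coordinates `[x : y]`. -/
def homog (x y : ℂ) : Sphere := if y = 0 then OnePoint.infty else ((x / y : ℂ) : Sphere)

lemma homog_zero (x : ℂ) : homog x 0 = OnePoint.infty := by simp [homog]

lemma homog_of_ne (x : ℂ) {y : ℂ} (hy : y ≠ 0) : homog x y = ((x / y : ℂ) : Sphere) := by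
  simp [homog, hy]

lemma homog_one (x : ℂ) : homog x 1 = (x : Sphere) := by simp [homog]

lemma homog_mul {k : ℂ} (hk : k ≠ 0) (x y : ℂ) : homog (k * x) (k * y) = homog x y := by
  by_cases hy : y = 0
  · simp [hy, homog]
  · rw [homog_of_ne _ (mul_ne_zero hk hy), homog_of_ne _ hy, mul_div_mul_left _ _ hk]

lemma exists_homog (z : Sphere) : ∃ x y : ℂ, (x ≠ 0 ∨ y ≠ 0) ∧ homog x y = z := by
  induction z using OnePoint.rec with
  | infty => exact ⟨1, 0, by simp, homog_zero 1⟩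
  | coe z => exact ⟨z, 1, by simp, homog_one z⟩

lemma continuousAt_homog {x y : ℂ} (h : x ≠ 0 ∨ y ≠ 0) :
    ContinuousAt (fun v : ℂ × ℂ => homog v.1 v.2) (x, y) := by
  by_cases hy : y = 0
  · have hx : x ≠ 0 := h.resolve_right (by simp [hy])
    subst hy
    rw [ContinuousAt, homog_zero]
    intro V hV
    have hV' : ((↑) : ℂ → Sphere) ⁻¹' V ∈ Bornology.cobounded ℂ := by
      rw [Metric.cobounded_eq_cocompact, ← coclosedCompact_eq_cocompact]
      exact OnePoint.tendsto_coe_infty hV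
    obtain ⟨R, -, hR⟩ := (hasBasis_cobounded_norm (E := ℂ)).mem_iff.1 hV'
    -- Near `(x, 0)` with `x ≠ 0` the quotient `v.1 / v.2` exceeds any bound `R`; the product form
    -- also makes sense at `v.2 = 0`.
    have h1 : ∀ᶠ v : ℂ × ℂ in 𝓝 (x, 0), R * ‖v.2‖ < ‖v.1‖ := by
      have hc : ContinuousAt (fun v : ℂ × ℂ => ‖v.1‖ - R * ‖v.2‖) (x, 0) := by fun_prop
      have := hc.eventually (lt_mem_nhds (a := 0) (by simpa using hx))
      filter_upwards [this] with v hv using by linarith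
    rw [mem_map]
    filter_upwards [h1] with v hv
    by_cases hv2 : v.2 = 0
    · simpa [hv2, homog_zero] using mem_of_mem_nhds hV
    · rw [Set.mem_preimage, homog_of_ne _ hv2]
      refine hR (a := v.1 / v.2) ?_
      rw [Set.mem_ofPred_eq, norm_div, le_div_iff₀ (norm_pos_iff.2 hv2)]
      exact hv.le
  · have h1 : ContinuousAt (fun v : ℂ × ℂ => ((v.1 / v.2 : ℂ) : Sphere)) (x, y) :=
      (OnePoint.continuous_coe.continuousAt).comp
        (f := fun v : ℂ × ℂ => v.1 / v.2) (continuousAt_fst.div continuousAt_snd hy)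
    refine h1.congr ?_
    have : ∀ᶠ v : ℂ × ℂ in 𝓝 (x, y), v.2 ≠ 0 := continuousAt_snd.eventually_ne hy
    filter_upwards [this] with v hv
    rw [homog_of_ne _ hv]

/-- A homogeneous formula covers both charts: `[w : 1]` handles finite points, and `[1 : w⁻¹]` turns
continuity at `∞` into continuity at `w⁻¹ = 0`. -/
lemma continuous_of_homog {S : Sphere → Sphere} {X Y : ℂ × ℂ → ℂ} (hX : Continuous X)
    (hY : Continuous Y) (hne : ∀ x y : ℂ, x ≠ 0 ∨ y ≠ 0 → X (x, y) ≠ 0 ∨ Y (x, y) ≠ 0)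
    (h : ∀ x y : ℂ, x ≠ 0 ∨ y ≠ 0 → S (homog x y) = homog (X (x, y)) (Y (x, y))) :
    Continuous S := by
  have key : ∀ x y : ℂ, x ≠ 0 ∨ y ≠ 0 →
      ContinuousAt (fun v : ℂ × ℂ => homog (X v) (Y v)) (x, y) := fun x y hxy =>
    (continuousAt_homog (hne x y hxy)).comp
      (f := fun v : ℂ × ℂ => (X v, Y v)) (hX.prodMk hY).continuousAt
  rw [continuous_iff_continuousAt]
  intro z
  induction z using OnePoint.rec with
  | infty =>
    rw [OnePoint.continuousAt_infty', ← homog_zero 1, h 1 0 (by simp)]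
    have h0 : Tendsto (fun w : ℂ => homog (X (1, w)) (Y (1, w))) (𝓝 0)
        (𝓝 (homog (X (1, 0)) (Y (1, 0)))) :=
      (key 1 0 (by simp)).comp (f := fun w : ℂ => ((1 : ℂ), w)) (by fun_prop)
    have hi : Tendsto (fun w : ℂ => w⁻¹) (coclosedCompact ℂ) (𝓝 0) := by
      rw [coclosedCompact_eq_cocompact, ← Metric.cobounded_eq_cocompact]
      exact tendsto_inv₀_cobounded
    refine (h0.comp hi).congr' ?_
    have hc : ∀ᶠ w : ℂ in coclosedCompact ℂ, w ≠ 0 := by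
      rw [coclosedCompact_eq_cocompact, ← Metric.cobounded_eq_cocompact]
      exact Bornology.eventually_ne_cobounded 0
    filter_upwards [hc] with w hw
    have : homog 1 w⁻¹ = (w : Sphere) := by
      rw [homog_of_ne _ (inv_ne_zero hw)]; simp
    simp only [Function.comp]
    rw [← h 1 w⁻¹ (by simp), this]
  | coe z =>
    rw [OnePoint.continuousAt_coe]
    have : S ∘ (fun z : ℂ => (z : Sphere)) = fun w : ℂ => homog (X (w, 1)) (Y (w, 1)) := by
      funext w
      rw [Function.comp, ← homog_one, h w 1 (by simp)]
    rw [this]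
    exact (key z 1 (by simp)).comp (f := fun w : ℂ => (w, (1 : ℂ))) (by fun_prop)

lemma homog_mem_realCircle {x y : ℂ} :
    homog x y ∈ realCircle ↔ (x * (starRingEnd ℂ) y).im = 0 := by
  by_cases hy : y = 0
  · simp [hy, homog, realCircle]
  · rw [homog_of_ne _ hy]
    have hn : Complex.normSq y ≠ 0 := by simpa using hy
    have h1 : (x * (starRingEnd ℂ) y).im = (x / y).im * Complex.normSq y := by
      have : x * (starRingEnd ℂ) y = (x / y) * (Complex.normSq y : ℂ) := by
        rw [Complex.normSq_eq_conj_mul_self]; field_simp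
      rw [this, Complex.im_mul_ofReal]
    rw [h1, mul_eq_zero, or_iff_left hn]
    simp only [realCircle, Set.mem_insert_iff, OnePoint.coe_ne_infty, false_or, Set.mem_range,
      OnePoint.coe_eq_coe]
    constructor
    · rintro ⟨r, hr⟩
      rw [← hr]; simp
    · intro h
      exact ⟨(x / y).re, Complex.ext (by simp) (by simp [h])⟩

/-! ### Basins and the Fatou set -/

/-- The basin of a point: all points whose orbit converges to it. -/
def basin (F : Sphere → Sphere) (p : Sphere) : Set Sphere :=
  {z | Tendsto (fun n : ℕ => F^[n] z) atTop (𝓝 p)}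

/-- `p` has a neighbourhood on which the iterates converge to `p` uniformly. -/
def UniformlyAttracting (F : Sphere → Sphere) (p : Sphere) : Prop :=
  ∃ U ∈ 𝓝 p, ∀ V ∈ 𝓝 p, ∀ᶠ n in atTop, Set.MapsTo (F^[n]) U V

lemma mem_basin_iterate_iff {F : Sphere → Sphere} {p z : Sphere} (n : ℕ) :
    F^[n] z ∈ basin F p ↔ z ∈ basin F p := by
  simp only [basin, Set.mem_ofPred_eq, ← Function.iterate_add_apply]
  exact tendsto_add_atTop_iff_nat (f := fun m => F^[m] z) n

lemma mem_basin_apply_iff {F : Sphere → Sphere} {p z : Sphere} :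
    F z ∈ basin F p ↔ z ∈ basin F p := mem_basin_iterate_iff 1

/-- Once the orbit of `z` enters the uniformly attracted neighbourhood, its interior is pulled back
by that iterate. -/
lemma UniformlyAttracting.exists_isOpen {F : Sphere → Sphere} {p : Sphere} (hF : Continuous F)
    (h : UniformlyAttracting F p) {z : Sphere} (hz : z ∈ basin F p) :
    ∃ O : Set Sphere, IsOpen O ∧ z ∈ O ∧
      ∀ V ∈ 𝓝 p, ∀ᶠ n in atTop, Set.MapsTo (F^[n]) O V := by
  obtain ⟨U, hU, hV⟩ := h
  obtain ⟨n, hn⟩ := (hz.eventually (interior_mem_nhds.2 hU)).exists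
  refine ⟨F^[n] ⁻¹' interior U, isOpen_interior.preimage (hF.iterate n), hn, fun V hVp => ?_⟩
  have h1 := hV V hVp
  filter_upwards [(tendsto_sub_atTop_nat n).eventually h1, eventually_ge_atTop n] with m hm hnm w hw
  rw [← Nat.sub_add_cancel hnm, Function.iterate_add_apply]
  exact hm (interior_subset hw)

lemma isOpen_basin {F : Sphere → Sphere} {p : Sphere} (hF : Continuous F)
    (h : UniformlyAttracting F p) : IsOpen (basin F p) := by
  rw [isOpen_iff_mem_nhds]
  intro z hz
  obtain ⟨O, hO, hzO, hV⟩ := h.exists_isOpen hF hz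
  filter_upwards [hO.mem_nhds hzO] with w hw
  exact tendsto_def.2 fun V hVp => (hV V hVp).mono fun n hn => hn hw

lemma basin_subset_fatouSet {F : Sphere → Sphere} {p : Sphere} (hF : Continuous F)
    (h : UniformlyAttracting F p) : basin F p ⊆ fatouSet F := by
  intro z hz
  obtain ⟨O, hO, hzO, hV⟩ := h.exists_isOpen hF hz
  refine ⟨O, hO, hzO, fun s hs => ?_⟩
  choose j hj using hs
  -- Either one exponent recurs infinitely often and gives a constant subsequence, or the exponents
  -- tend to infinity and the whole sequence converges to `p`.
  by_cases hfreq : ∃ m, ∃ᶠ k in atTop, j k = m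
  · obtain ⟨m, hm⟩ := hfreq
    obtain ⟨φ, hφ, hφm⟩ := extraction_of_frequently_atTop hm
    refine ⟨φ, hφ, F^[m], TendstoUniformlyOn.tendstoLocallyUniformlyOn ?_⟩
    intro u hu
    refine Eventually.of_forall fun k x _ => ?_
    simp only [← hj, hφm]
    exact refl_mem_uniformity hu
  · push Not at hfreq
    have hj' : Tendsto j atTop atTop := by
      rw [tendsto_atTop]
      intro N
      have : ∀ᶠ k in atTop, ∀ m ∈ Set.Iio N, j k ≠ m :=
        (eventually_all_finite (Set.finite_Iio N)).2 fun m _ => hfreq m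
      filter_upwards [this] with k hk
      by_contra hlt
      exact hk _ (not_le.1 hlt) rfl
    refine ⟨id, strictMono_id, fun _ => p, TendstoUniformlyOn.tendstoLocallyUniformlyOn ?_⟩
    intro u hu
    filter_upwards [hj'.eventually (hV _ (UniformSpace.ball_mem_nhds p hu))] with k hk x hx
    simp only [id, ← hj]
    exact hk hx

/-! ### Local charts and attracting fixed points -/

lemma coord_infty_coe (w : ℂ) : coord OnePoint.infty (w : Sphere) = w⁻¹ := rfl

lemma coord_coe_coe (a w : ℂ) : coord (a : Sphere) (w : Sphere) = w := rfl

lemma coord_infty_infty : coord OnePoint.infty OnePoint.infty = 0 := rfl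

lemma param_coe (a z : ℂ) : param (a : Sphere) z = homog (a + z) 1 := (homog_one _).symm

lemma param_infty (z : ℂ) : param OnePoint.infty z = homog 1 z := by
  by_cases hz : z = 0
  · simp [param, homog, hz]
  · simp [param, homog, hz]

lemma param_zero (p : Sphere) : param p 0 = p := by
  induction p using OnePoint.rec with
  | infty => rw [param_infty, homog_zero]
  | coe a => rw [param_coe, add_zero, homog_one]

lemma continuousAt_param (p : Sphere) : ContinuousAt (param p) 0 := by
  induction p using OnePoint.rec with
  | infty =>
    rw [show param OnePoint.infty = _ from funext param_infty]
    exact (continuousAt_homog (x := 1) (y := 0) (by simp)).comp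
      (f := fun w : ℂ => ((1 : ℂ), w)) (by fun_prop)
  | coe a =>
    rw [show param (a : Sphere) = _ from funext (param_coe a)]
    exact (continuousAt_homog (x := a + 0) (y := 1) (by simp)).comp
      (f := fun w : ℂ => (a + w, (1 : ℂ))) (by fun_prop)

lemma continuousAt_coord (p : Sphere) : ContinuousAt (coord p) p := by
  induction p using OnePoint.rec with
  | infty =>
    rw [OnePoint.continuousAt_infty', coclosedCompact_eq_cocompact,
      ← Metric.cobounded_eq_cocompact]
    exact tendsto_inv₀_cobounded
  | coe a =>
    rw [OnePoint.continuousAt_coe]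
    exact continuousAt_id

lemma eventually_param_coord (p : Sphere) :
    ∀ᶠ w in 𝓝 p, param p (coord p w - coord p p) = w := by
  induction p using OnePoint.rec with
  | infty =>
    filter_upwards [isOpen_ne.mem_nhds (OnePoint.infty_ne_coe (0 : ℂ))] with w hw
    induction w using OnePoint.rec with
    | infty => simp [coord_infty_infty, param_zero]
    | coe w =>
      have : w ≠ 0 := fun h => hw (by rw [h])
      rw [coord_infty_coe, coord_infty_infty, sub_zero, param_infty,
        homog_of_ne _ (inv_ne_zero this)]
      simp
  | coe a =>
    filter_upwards [isOpen_ne.mem_nhds (OnePoint.coe_ne_infty a)] with w hw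
    induction w using OnePoint.rec with
    | infty => exact absurd rfl hw
    | coe w => rw [coord_coe_coe, coord_coe_coe, param_coe, add_sub_cancel, homog_one]

lemma UniformlyAttracting.of_parametrisation {F : Sphere → Sphere} {p : Sphere} {ψ : ℂ → Sphere}
    {k : ℂ → ℂ} {l r : ℝ} (hψ : ContinuousAt ψ 0) (hψ0 : ψ 0 = p) (hl0 : 0 ≤ l) (hl : l < 1)
    (himg : ψ '' Metric.ball 0 r ∈ 𝓝 p)
    (hk : ∀ z, ‖z‖ < r → F (ψ z) = ψ (k z) ∧ ‖k z‖ ≤ l * ‖z‖) : UniformlyAttracting F p := by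
  refine ⟨_, himg, fun V hV => ?_⟩
  rw [← hψ0] at hV
  obtain ⟨δ, hδ, hball⟩ := Metric.mem_nhds_iff.1 (hψ hV)
  have hlim : Tendsto (fun n : ℕ => l ^ n * r) atTop (𝓝 0) := by
    simpa using (tendsto_pow_atTop_nhds_zero_of_lt_one hl0 hl).mul_const r
  filter_upwards [hlim.eventually (gt_mem_nhds hδ)] with n hn
  rintro _ ⟨z, hz, rfl⟩
  rw [mem_ball_zero_iff] at hz
  have hit : ∀ m : ℕ, F^[m] (ψ z) = ψ (k^[m] z) ∧ ‖k^[m] z‖ ≤ l ^ m * ‖z‖ := by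
    intro m
    induction m with
    | zero => simp
    | succ m ih =>
      have hlt : ‖k^[m] z‖ < r :=
        (ih.2.trans (mul_le_of_le_one_left (norm_nonneg _) (pow_le_one₀ hl0 hl.le))).trans_lt hz
      obtain ⟨h1, h2⟩ := hk _ hlt
      rw [Function.iterate_succ_apply', Function.iterate_succ_apply', ih.1, h1]
      refine ⟨rfl, h2.trans ?_⟩
      rw [pow_succ', mul_assoc]
      exact mul_le_mul_of_nonneg_left ih.2 hl0
  rw [(hit n).1]
  refine hball ?_
  rw [mem_ball_zero_iff]
  refine (hit n).2.trans_lt (lt_of_le_of_lt ?_ hn)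
  exact mul_le_mul_of_nonneg_left hz.le (pow_nonneg hl0 n)

lemma IsAttractingFixedPoint.uniformlyAttracting {F : Sphere → Sphere} {p : Sphere}
    (hF : ContinuousAt F p) (h : IsAttractingFixedPoint F p) : UniformlyAttracting F p := by
  obtain ⟨hp, μ, hμ, hμ1⟩ := h
  obtain ⟨l, hμl, hl1⟩ := exists_between hμ1
  have hcomp : Tendsto (fun z => F (param p z)) (𝓝 0) (𝓝 p) := by
    have h1 : Tendsto (param p) (𝓝 0) (𝓝 p) := by
      simpa [ContinuousAt, param_zero] using continuousAt_param p
    have h2 : Tendsto F (𝓝 p) (𝓝 p) := by simpa [ContinuousAt, hp] using hF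
    exact h2.comp h1
  -- `param p` is centred at `0`, but `coord p` is not when `p` is finite; `coord p p` has to be
  -- subtracted to obtain a self-map fixing `0`.
  have h0 : localExpr F p 0 = coord p p := by simp [localExpr, param_zero, hp]
  have hbound : ∀ᶠ z in 𝓝 (0 : ℂ), ‖localExpr F p z - coord p p‖ ≤ l * ‖z‖ := by
    have := (hasDerivAt_iff_isLittleO.1 hμ).bound (sub_pos.2 hμl)
    filter_upwards [this] with z hz
    rw [h0, sub_zero, smul_eq_mul] at hz
    calc ‖localExpr F p z - coord p p‖
        = ‖(localExpr F p z - coord p p - z * μ) + z * μ‖ := by ring_nf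
      _ ≤ (l - ‖μ‖) * ‖z‖ + ‖z‖ * ‖μ‖ := (norm_add_le _ _).trans (by rw [norm_mul]; gcongr)
      _ = l * ‖z‖ := by ring
  obtain ⟨r, hr, hball⟩ := Metric.eventually_nhds_iff_ball.1
    (hbound.and (hcomp.eventually (eventually_param_coord p)))
  refine UniformlyAttracting.of_parametrisation (ψ := param p) (l := l) (r := r)
    (k := fun z => localExpr F p z - coord p p) (continuousAt_param p) (param_zero p)
    ((norm_nonneg μ).trans hμl.le) hl1 ?_ fun z hz => ?_
  · have hc : Tendsto (fun w => coord p w - coord p p) (𝓝 p) (𝓝 0) := by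
      simpa using (continuousAt_coord p).tendsto.sub_const (coord p p)
    filter_upwards [hc.eventually (Metric.ball_mem_nhds 0 hr), eventually_param_coord p]
      with w hw hw'
    exact ⟨_, hw, hw'⟩
  · obtain ⟨h1, h2⟩ := hball z (by simpa using hz)
    refine ⟨?_, h1⟩
    simp only [localExpr, hp]
    exact h2.symm

lemma basin_semiconj {F G m : Sphere → Sphere} (hm : Continuous m)
    (h : Function.Semiconj m F G) {p z : Sphere} (hz : z ∈ basin F p) : m z ∈ basin G (m p) := by
  have h1 := (hm.tendsto p).comp hz
  refine h1.congr fun n => ?_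
  exact (h.iterate_right n) z

/-! ### Quadratic maps as pairs of binary forms -/

/-- A pair of real binary quadratic forms `(a x² + b x y + c y², d x² + e x y + g y²)`. -/
structure QuadPair where
  (a b c d e g : ℝ)

namespace QuadPair

variable (q : QuadPair)

/-- The first form. -/
def num (x y : ℂ) : ℂ := q.a * x ^ 2 + q.b * (x * y) + q.c * y ^ 2

/-- The second form. -/
def den (x y : ℂ) : ℂ := q.d * x ^ 2 + q.e * (x * y) + q.g * y ^ 2

/-- Half the Jacobian determinant of the pair; its zeros are the critical points. -/
def jac (x y : ℂ) : ℂ :=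
  (q.a * q.e - q.b * q.d) * x ^ 2 + 2 * (q.a * q.g - q.c * q.d) * (x * y) +
    (q.b * q.g - q.c * q.e) * y ^ 2

/-- The two forms have no common zero on the projective line over `ℂ`. -/
def IsReduced : Prop := ∀ x y : ℂ, x ≠ 0 ∨ y ≠ 0 → q.num x y ≠ 0 ∨ q.den x y ≠ 0

/-- The self-map of the Riemann sphere given by a pair of quadratic forms. -/
def toMap : Sphere → Sphere
  | OnePoint.some z => homog (q.num z 1) (q.den z 1)
  | OnePoint.infty => homog q.a q.d

lemma toMap_coe (z : ℂ) : q.toMap (z : Sphere) = homog (q.num z 1) (q.den z 1) := rfl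

lemma toMap_infty : q.toMap OnePoint.infty = homog q.a q.d := rfl

lemma toMap_homog {x y : ℂ} (h : x ≠ 0 ∨ y ≠ 0) :
    q.toMap (homog x y) = homog (q.num x y) (q.den x y) := by
  by_cases hy : y = 0
  · have hx : x ≠ 0 := h.resolve_right (by simp [hy])
    rw [hy, homog_zero, toMap_infty, ← homog_mul (pow_ne_zero 2 hx)]
    congr 1 <;> simp only [num, den] <;> ring
  · rw [homog_of_ne _ hy, toMap_coe, ← homog_mul (pow_ne_zero 2 hy)]
    congr 1 <;> simp only [num, den] <;> field_simp

variable {q}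

lemma continuous_toMap (hq : q.IsReduced) : Continuous q.toMap := by
  refine continuous_of_homog (X := fun v => q.num v.1 v.2) (Y := fun v => q.den v.1 v.2) ?_ ?_
    hq fun x y h => q.toMap_homog h
  · unfold num; fun_prop
  · unfold den; fun_prop

lemma coord_coe_homog (w x y : ℂ) : coord (w : Sphere) (homog x y) = x / y := by
  by_cases hy : y = 0
  · rw [hy, homog_zero, div_zero]; rfl
  · rw [homog_of_ne _ hy, coord_coe_coe]

lemma coord_infty_homog (x y : ℂ) : coord OnePoint.infty (homog x y) = y / x := by
  by_cases hy : y = 0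
  · rw [hy, homog_zero, zero_div]; rfl
  · rw [homog_of_ne _ hy, coord_infty_coe, inv_div]

/-! ### Derivatives, critical points and multipliers -/

lemma hasDerivAt_quadratic_zero (A B C : ℂ) :
    HasDerivAt (fun h : ℂ => A * h ^ 2 + B * h + C) B 0 := by
  have h1 := (((hasDerivAt_pow 2 (0 : ℂ)).const_mul A).add
    ((hasDerivAt_id (0 : ℂ)).const_mul B)).add_const C
  simpa using h1

lemma hasDerivAt_quadratic_div {A B C A' B' C' : ℂ} (h : C' ≠ 0) :
    HasDerivAt (fun h : ℂ => (A * h ^ 2 + B * h + C) / (A' * h ^ 2 + B' * h + C'))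
      ((B * C' - C * B') / C' ^ 2) 0 := by
  have := (hasDerivAt_quadratic_zero A B C).div (hasDerivAt_quadratic_zero A' B' C')
    (by simpa using h)
  simp only [ne_eq, OfNat.ofNat_ne_zero, not_false_eq_true, zero_pow, mul_zero, add_zero,
    zero_add] at this
  exact this

lemma num_add (z h : ℂ) :
    q.num (z + h) 1 = q.a * h ^ 2 + (2 * q.a * z + q.b) * h + q.num z 1 := by
  simp only [num]; ring

lemma den_add (z h : ℂ) :
    q.den (z + h) 1 = q.d * h ^ 2 + (2 * q.d * z + q.e) * h + q.den z 1 := by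
  simp only [den]; ring

/-- In every choice of charts the derivative is, up to sign, the Jacobian form divided by the square
of a nonvanishing form. This lemma and the next three cover finite or infinite source and target. -/
lemma hasDerivAt_localExpr_coe {z : ℂ} (h : q.den z 1 ≠ 0) :
    HasDerivAt (localExpr q.toMap (z : Sphere)) (q.jac z 1 / q.den z 1 ^ 2) 0 := by
  have h1 := hasDerivAt_quadratic_div (A := q.a) (B := 2 * q.a * z + q.b) (C := q.num z 1)
    (A' := q.d) (B' := 2 * q.d * z + q.e) h
  have h2 : localExpr q.toMap (z : Sphere) = fun h : ℂ =>
      (q.a * h ^ 2 + (2 * q.a * z + q.b) * h + q.num z 1) /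
      (q.d * h ^ 2 + (2 * q.d * z + q.e) * h + q.den z 1) := by
    funext w
    rw [localExpr, toMap_coe, homog_of_ne _ h, param_coe, toMap_homog _ (by simp),
      coord_coe_homog, num_add, den_add]
  rw [h2]
  convert h1 using 2
  simp only [jac, num, den]; ring

lemma hasDerivAt_localExpr_coe' {z : ℂ} (h : q.den z 1 = 0) (h' : q.num z 1 ≠ 0) :
    HasDerivAt (localExpr q.toMap (z : Sphere)) (-q.jac z 1 / q.num z 1 ^ 2) 0 := by
  have h1 := hasDerivAt_quadratic_div (A' := q.a) (B' := 2 * q.a * z + q.b) (C' := q.num z 1)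
    (A := q.d) (B := 2 * q.d * z + q.e) (C := q.den z 1) h'
  have h2 : localExpr q.toMap (z : Sphere) = fun h : ℂ =>
      (q.d * h ^ 2 + (2 * q.d * z + q.e) * h + q.den z 1) /
      (q.a * h ^ 2 + (2 * q.a * z + q.b) * h + q.num z 1) := by
    funext w
    rw [localExpr, toMap_coe, h, homog_zero, param_coe, toMap_homog _ (by simp),
      coord_infty_homog, num_add, den_add, h]
  rw [h2]
  convert h1 using 2
  simp only [jac, num, den]; ring

lemma num_one (h : ℂ) : q.num 1 h = q.c * h ^ 2 + q.b * h + q.a := by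
  simp only [num]; ring

lemma den_one (h : ℂ) : q.den 1 h = q.g * h ^ 2 + q.e * h + q.d := by
  simp only [den]; ring

lemma hasDerivAt_localExpr_infty (h : q.d ≠ 0) :
    HasDerivAt (localExpr q.toMap OnePoint.infty) (-q.jac 1 0 / q.d ^ 2) 0 := by
  have hd : (q.d : ℂ) ≠ 0 := by exact_mod_cast h
  have h1 := hasDerivAt_quadratic_div (A := q.c) (B := q.b) (C := q.a) (A' := q.g) (B' := q.e) hd
  have h2 : localExpr q.toMap OnePoint.infty = fun h : ℂ =>
      (q.c * h ^ 2 + q.b * h + q.a) / (q.g * h ^ 2 + q.e * h + q.d) := by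
    funext w
    rw [localExpr, toMap_infty, homog_of_ne _ hd, param_infty, toMap_homog _ (by simp),
      coord_coe_homog, num_one, den_one]
  rw [h2]
  convert h1 using 2
  simp only [jac]; ring

lemma hasDerivAt_localExpr_infty' (h : q.d = 0) (h' : q.a ≠ 0) :
    HasDerivAt (localExpr q.toMap OnePoint.infty) (q.jac 1 0 / q.a ^ 2) 0 := by
  have ha : (q.a : ℂ) ≠ 0 := by exact_mod_cast h'
  have h1 := hasDerivAt_quadratic_div (A' := q.c) (B' := q.b) (C' := q.a) (A := q.g) (B := q.e)
    (C := q.d) ha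
  have h2 : localExpr q.toMap OnePoint.infty = fun h : ℂ =>
      (q.g * h ^ 2 + q.e * h + q.d) / (q.c * h ^ 2 + q.b * h + q.a) := by
    funext w
    rw [localExpr, toMap_infty, h, Complex.ofReal_zero, homog_zero, param_infty,
      toMap_homog _ (by simp), coord_infty_homog, num_one, den_one, h, Complex.ofReal_zero]
  rw [h2]
  convert h1 using 2
  simp only [jac]; ring

lemma isCriticalPoint_homog (hq : q.IsReduced) {x y : ℂ} (h : x ≠ 0 ∨ y ≠ 0)
    (hj : q.jac x y = 0) : IsCriticalPoint q.toMap (homog x y) := by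
  by_cases hy : y = 0
  · have hx : x ≠ 0 := h.resolve_right (by simp [hy])
    have hj' : q.jac 1 0 = 0 := by
      have : q.jac x y = x ^ 2 * q.jac 1 0 := by rw [hy]; simp only [jac]; ring
      rw [this] at hj
      exact (mul_eq_zero.1 hj).resolve_left (pow_ne_zero 2 hx)
    rw [hy, homog_zero, IsCriticalPoint]
    by_cases hd : q.d = 0
    · have ha : q.a ≠ 0 := by
        intro ha
        simpa [num, den, ha, hd] using hq 1 0 (by simp)
      simpa [hj'] using hasDerivAt_localExpr_infty' hd ha
    · simpa [hj'] using hasDerivAt_localExpr_infty hd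
  · rw [homog_of_ne _ hy, IsCriticalPoint]
    have hj' : q.jac (x / y) 1 = 0 := by
      have : q.jac x y = y ^ 2 * q.jac (x / y) 1 := by simp only [jac]; field_simp
      rw [this] at hj
      exact (mul_eq_zero.1 hj).resolve_left (pow_ne_zero 2 hy)
    by_cases hd : q.den (x / y) 1 = 0
    · simpa [hj'] using
        hasDerivAt_localExpr_coe' hd ((hq (x / y) 1 (by simp)).resolve_right (by simp [hd]))
    · simpa [hj'] using hasDerivAt_localExpr_coe hd

lemma norm_jac_lt_of_attracting_coe {z : ℂ} (h : IsAttractingFixedPoint q.toMap (z : Sphere)) :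
    q.num z 1 = q.den z 1 * z ∧ q.den z 1 ≠ 0 ∧ ‖q.jac z 1‖ < ‖q.den z 1‖ ^ 2 := by
  obtain ⟨hfix, μ, hμ, hμ1⟩ := h
  rw [toMap_coe] at hfix
  have hd : q.den z 1 ≠ 0 := by
    intro hd
    rw [hd, homog_zero] at hfix
    exact OnePoint.infty_ne_coe z hfix
  rw [homog_of_ne _ hd, OnePoint.coe_eq_coe, div_eq_iff hd] at hfix
  refine ⟨by rw [hfix, mul_comm], hd, ?_⟩
  rw [hμ.unique (hasDerivAt_localExpr_coe hd), norm_div, norm_pow,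
    div_lt_one (pow_pos (norm_pos_iff.2 hd) 2)] at hμ1
  exact hμ1

lemma abs_lt_of_attracting_infty (hq : q.IsReduced)
    (h : IsAttractingFixedPoint q.toMap OnePoint.infty) : q.d = 0 ∧ |q.e| < |q.a| := by
  obtain ⟨hfix, μ, hμ, hμ1⟩ := h
  rw [toMap_infty] at hfix
  have hd : q.d = 0 := by
    by_contra hd
    rw [homog_of_ne _ (by exact_mod_cast hd)] at hfix
    exact OnePoint.coe_ne_infty _ hfix
  have ha : q.a ≠ 0 := by
    intro ha
    simpa [num, den, ha, hd] using hq 1 0 (by simp)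
  refine ⟨hd, ?_⟩
  have hac : (q.a : ℂ) ≠ 0 := by exact_mod_cast ha
  have h1 : q.jac 1 0 / (q.a : ℂ) ^ 2 = ((q.e / q.a : ℝ) : ℂ) := by
    simp only [jac, hd]; push_cast; field_simp; ring
  rw [hμ.unique (hasDerivAt_localExpr_infty' hd ha), h1, Complex.norm_real, Real.norm_eq_abs,
    abs_div, div_lt_one (abs_pos.2 ha)] at hμ1
  exact hμ1

/-- Without at least one critical point, the hypothesis on critical orbits would say nothing about
`p`. -/
lemma exists_jac_eq_zero (q : QuadPair) : ∃ x y : ℂ, (x ≠ 0 ∨ y ≠ 0) ∧ q.jac x y = 0 := by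
  by_cases h : (q.a * q.e - q.b * q.d : ℂ) = 0
  · exact ⟨1, 0, by simp, by simp [jac, h]⟩
  · obtain ⟨s, hs⟩ := IsAlgClosed.exists_eq_mul_self (discrim (q.a * q.e - q.b * q.d : ℂ)
      (2 * (q.a * q.g - q.c * q.d)) (q.b * q.g - q.c * q.e))
    obtain ⟨x, hx⟩ := exists_quadratic_eq_zero h ⟨s, hs⟩
    refine ⟨x, 1, by simp, ?_⟩
    rw [← hx]; simp only [jac]; ring

lemma conj_jac (x y : ℂ) :
    q.jac ((starRingEnd ℂ) x) ((starRingEnd ℂ) y) = (starRingEnd ℂ) (q.jac x y) := by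
  simp [jac, map_ofNat]

/-! ### Conjugation symmetry -/

/-- Complex conjugation on the Riemann sphere. -/
def sphereConj : Sphere → Sphere := OnePoint.map (starRingEnd ℂ)

lemma sphereConj_homog (x y : ℂ) :
    sphereConj (homog x y) = homog ((starRingEnd ℂ) x) ((starRingEnd ℂ) y) := by
  by_cases hy : y = 0
  · simp only [hy, map_zero, homog_zero]; rfl
  · rw [homog_of_ne _ hy, homog_of_ne _ (by simpa using hy), ← map_div₀]; rfl

lemma continuous_sphereConj : Continuous sphereConj := by
  refine continuous_of_homog (X := fun v => (starRingEnd ℂ) v.1)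
    (Y := fun v => (starRingEnd ℂ) v.2) (Complex.continuous_conj.comp continuous_fst)
    (Complex.continuous_conj.comp continuous_snd) (fun x y h => ?_)
    fun x y _ => sphereConj_homog x y
  simpa using h

lemma semiconj_sphereConj (q : QuadPair) : Function.Semiconj sphereConj q.toMap q.toMap := by
  intro z
  obtain ⟨x, y, h, rfl⟩ := exists_homog z
  rw [toMap_homog _ h, sphereConj_homog, sphereConj_homog, toMap_homog _ (by simpa using h)]
  simp [num, den]

/-- Every critical orbit converges to `p`. -/
def CriticalInBasin (q : QuadPair) (p : Sphere) : Prop :=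
  ∀ x y : ℂ, x ≠ 0 ∨ y ≠ 0 → q.jac x y = 0 → homog x y ∈ basin q.toMap p

/-- The conjugate of a critical orbit is again a critical orbit, so it converges both to `p` and to
the conjugate of `p`. -/
lemma CriticalInBasin.mem_realCircle {p : Sphere} (h : q.CriticalInBasin p) :
    p ∈ realCircle := by
  obtain ⟨x, y, hxy, hj⟩ := q.exists_jac_eq_zero
  have h1 := h x y hxy hj
  have h2 := h ((starRingEnd ℂ) x) ((starRingEnd ℂ) y) (by simpa using hxy)
    (by rw [conj_jac, hj, map_zero])
  have h3 := basin_semiconj continuous_sphereConj q.semiconj_sphereConj h1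
  rw [sphereConj_homog] at h3
  have hp : sphereConj p = p := tendsto_nhds_unique h3 h2
  induction p using OnePoint.rec with
  | infty => exact Set.mem_insert _ _
  | coe z =>
    have : (starRingEnd ℂ) z = z := OnePoint.coe_injective hp
    rw [← homog_one, homog_mem_realCircle]
    simpa using Complex.conj_eq_iff_im.1 this

end QuadPair

/-! ### From rational functions to quadratic pairs -/

/-- The pair of quadratic forms of a rational function of degree two. -/
def quadPair (f : RatFunc ℝ) : QuadPair :=
  ⟨f.num.coeff 2, f.num.coeff 1, f.num.coeff 0, f.denom.coeff 2, f.denom.coeff 1, f.denom.coeff 0⟩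

lemma aeval_of_natDegree_le_two {P : Polynomial ℝ} (h : P.natDegree ≤ 2) (z : ℂ) :
    Polynomial.aeval z P = P.coeff 2 * z ^ 2 + P.coeff 1 * z + P.coeff 0 := by
  rw [Polynomial.aeval_eq_sum_range' (n := 3) (by omega)]
  simp [Finset.sum_range_succ]
  ring

lemma aeval_num {f : RatFunc ℝ} (hf : degree f = 2) (z : ℂ) :
    Polynomial.aeval z f.num = (quadPair f).num z 1 := by
  rw [aeval_of_natDegree_le_two (hf ▸ le_max_left _ _)]
  simp [QuadPair.num, quadPair]

lemma aeval_denom {f : RatFunc ℝ} (hf : degree f = 2) (z : ℂ) :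
    Polynomial.aeval z f.denom = (quadPair f).den z 1 := by
  rw [aeval_of_natDegree_le_two (hf ▸ le_max_right _ _)]
  simp [QuadPair.den, quadPair]

lemma sphereMap_eq_toMap {f : RatFunc ℝ} (hf : degree f = 2) :
    sphereMap f = (quadPair f).toMap := by
  funext z
  induction z using OnePoint.rec with
  | infty =>
    rw [QuadPair.toMap_infty]
    simp only [sphereMap, hf, homog, quadPair]
    simp
  | coe z =>
    rw [QuadPair.toMap_coe, ← aeval_num hf, ← aeval_denom hf]
    rfl

lemma quadPair_isReduced {f : RatFunc ℝ} (hf : degree f = 2) : (quadPair f).IsReduced := by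
  intro x y h
  by_contra hcon
  push Not at hcon
  obtain ⟨h1, h2⟩ := hcon
  -- A common zero at `∞` would lower the degree below two; a finite one contradicts coprimality.
  by_cases hy : y = 0
  · have hx : x ≠ 0 := h.resolve_right (by simp [hy])
    simp [hy, QuadPair.num, QuadPair.den, quadPair, hx] at h1 h2
    rcases max_choice f.num.natDegree f.denom.natDegree with hm | hm
    · have hn : f.num.natDegree = 2 := by rw [← hf, degree, hm]
      have : f.num.leadingCoeff = 0 := by rw [Polynomial.leadingCoeff, hn, h1]
      rw [Polynomial.leadingCoeff_eq_zero] at this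
      simp [this] at hn
    · have hn : f.denom.natDegree = 2 := by rw [← hf, degree, hm]
      have : f.denom.leadingCoeff = 0 := by rw [Polynomial.leadingCoeff, hn, h2]
      rw [Polynomial.leadingCoeff_eq_zero] at this
      simp [this] at hn
  · have e1 : (quadPair f).num (x / y) 1 = 0 := by
      have : (quadPair f).num x y = y ^ 2 * (quadPair f).num (x / y) 1 := by
        simp only [QuadPair.num]; field_simp
      rw [this] at h1
      exact (mul_eq_zero.1 h1).resolve_left (pow_ne_zero 2 hy)
    have e2 : (quadPair f).den (x / y) 1 = 0 := by
      have : (quadPair f).den x y = y ^ 2 * (quadPair f).den (x / y) 1 := by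
        simp only [QuadPair.den]; field_simp
      rw [this] at h2
      exact (mul_eq_zero.1 h2).resolve_left (pow_ne_zero 2 hy)
    rw [← aeval_num hf] at e1
    rw [← aeval_denom hf] at e2
    obtain ⟨u, v, huv⟩ := f.isCoprime_num_denom
    have := congrArg (Polynomial.aeval (x / y)) huv
    simp [e1, e2] at this

/-! ### The visual angle of a segment -/

/-- The real part of `(z - s) * conj (z - t)`: for nonreal `z`, the ratio of this number to
`(t - s) * |im z|` is the cotangent of the angle under which `[s, t]` is seen from `z`. -/
def segForm (s t : ℝ) (z : ℂ) : ℝ := (z.re - s) * (z.re - t) + z.im ^ 2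

lemma continuous_segForm (s t : ℝ) : Continuous (segForm s t) := by
  unfold segForm; fun_prop

/-- The cotangent of the visual angle would increase strictly under `f`, yet it attains a maximum on
a compact superlevel set that `f` preserves. -/
lemma im_eq_zero_of_angle_decreasing {K : Set ℂ} (hK : IsCompact K) {f : ℂ → ℂ}
    (hf : ∀ z ∈ K, f z ∈ K) {s t : ℝ} (hreal : ∀ x : ℝ, (x : ℂ) ∈ K → s < x ∧ x < t)
    (hstep : ∀ z ∈ K, z.im ≠ 0 → (f z).im ≠ 0 ∧
      segForm s t z * |(f z).im| < segForm s t (f z) * |z.im|) :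
    ∀ z ∈ K, z.im = 0 := by
  by_contra! hcon
  obtain ⟨z₀, hz₀, him₀⟩ := hcon
  set κ := segForm s t z₀ / |z₀.im| with hκ
  -- Written without division, the superlevel condition is closed across the real axis. At real
  -- points of `K` it fails, since `segForm` is negative there, so the cotangent is continuous on
  -- this set.
  have hS : IsCompact (K ∩ {z | κ * |z.im| ≤ segForm s t z}) :=
    hK.inter_right (isClosed_le (by fun_prop) (continuous_segForm s t))
  have him : ∀ z ∈ K ∩ {z | κ * |z.im| ≤ segForm s t z}, z.im ≠ 0 := by
    rintro z ⟨hz, hz'⟩ h0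
    rw [Set.mem_ofPred_eq, h0, abs_zero, mul_zero] at hz'
    have hzr : (z.re : ℂ) = z := Complex.ext (by simp) (by simp [h0])
    obtain ⟨h1, h2⟩ := hreal z.re (by rwa [hzr])
    simp only [segForm, h0] at hz'
    nlinarith
  have hne : (K ∩ {z | κ * |z.im| ≤ segForm s t z}).Nonempty := by
    refine ⟨z₀, hz₀, ?_⟩
    rw [Set.mem_ofPred_eq, hκ, div_mul_cancel₀ _ (abs_ne_zero.2 him₀)]
  obtain ⟨z₁, hz₁, hmax⟩ := hS.exists_isMaxOn (f := fun z => segForm s t z / |z.im|) hne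
    ((continuous_segForm s t).continuousOn.div (by fun_prop) fun z hz => abs_ne_zero.2 (him z hz))
  have hp₁ : 0 < |z₁.im| := abs_pos.2 (him z₁ hz₁)
  obtain ⟨h1, h2⟩ := hstep z₁ hz₁.1 (him z₁ hz₁)
  have hp₂ : 0 < |(f z₁).im| := abs_pos.2 h1
  have hlt : segForm s t z₁ / |z₁.im| < segForm s t (f z₁) / |(f z₁).im| := by
    rwa [div_lt_div_iff₀ hp₁ hp₂]
  have hmem : f z₁ ∈ K ∩ {z | κ * |z.im| ≤ segForm s t z} := by
    refine ⟨hf _ hz₁.1, ?_⟩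
    have hle : κ ≤ segForm s t z₁ / |z₁.im| := (le_div_iff₀ hp₁).2 hz₁.2
    exact (le_div_iff₀ hp₂).1 (hle.trans hlt.le)
  exact absurd (hmax hmem) (not_le.2 hlt)

/-- With `m / d = cot θ₁` and `n / e = cot θ₂`, this is `cot (θ₁ + θ₂) ≤ cot |θ₁ - θ₂|` cleared of
denominators; `h` says that `sin (θ₁ + θ₂) > 0`. -/
lemma cross_mul_le {m n d e : ℝ} (hd : 0 < d) (he : 0 < e) (h : 0 < m * e + n * d) :
    (m * n - d * e) * |m * e - n * d| ≤ (m * n + d * e) * (m * e + n * d) := by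
  rcases abs_cases (m * e - n * d) with ⟨h1, h2⟩ | ⟨h1, h2⟩
  · rw [h1]
    have hm : 0 < m := by
      by_contra hm
      nlinarith
    have : 0 ≤ m * d * (n ^ 2 + e ^ 2) := by positivity
    nlinarith
  · rw [h1]
    have hn : 0 < n := by
      by_contra hn
      nlinarith
    have : 0 ≤ n * e * (m ^ 2 + d ^ 2) := by positivity
    nlinarith

/-- The angle under which a segment is seen does not increase under folding it at an interior
point. -/
lemma segForm_fold_le {s c t α τ ρ : ℝ} (hsc : s < c) (hct : c < t) (hρ : 0 < ρ) (hατ : α < τ)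
    {z u : ℂ} (hz : z.im ≠ 0)
    (h : (ρ : ℂ) * ((u - α) * (starRingEnd ℂ) (u - τ)) =
      (z - c) ^ 2 * (starRingEnd ℂ) ((z - s) * (z - t))) :
    segForm s t z * ((τ - α) * |u.im|) ≤ segForm α τ u * ((t - s) * |z.im|) := by
  obtain ⟨x, y⟩ := z
  obtain ⟨v, w⟩ := u
  have hre := congrArg Complex.re h
  have him := congrArg Complex.im h
  simp [pow_two] at hre him hz
  simp only [segForm]
  -- `m / (|y| (c - s))` and `n / (|y| (t - c))` are the cotangents of the angles of `[s, c]` and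
  -- `[c, t]` at `z`. By `h`, the angle of `[α, τ]` at `u` is the absolute difference of these two.
  set m := (x - s) * (x - c) + y ^ 2 with hm
  set n := (x - c) * (x - t) + y ^ 2 with hn
  set M := (x - c) ^ 2 + y ^ 2 with hM
  have hy : 0 < |y| := abs_pos.2 hz
  have hMp : 0 < M := by positivity
  have hy2 : |y| ^ 2 = y ^ 2 := sq_abs y
  have e1 : M * ((x - s) * (x - t) + y ^ 2) = m * n - (|y| * (c - s)) * (|y| * (t - c)) := by
    have : (|y| * (c - s)) * (|y| * (t - c)) = y ^ 2 * (c - s) * (t - c) := by rw [← hy2]; ring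
    rw [this]; simp only [hm, hn, hM]; ring
  have e2 : M * ((t - s) * |y|) = m * (|y| * (t - c)) + n * (|y| * (c - s)) := by
    simp only [hm, hn, hM]; ring
  have e3 : ρ * ((v - α) * (v - τ) + w ^ 2) = m * n + (|y| * (c - s)) * (|y| * (t - c)) := by
    have : (|y| * (c - s)) * (|y| * (t - c)) = y ^ 2 * (c - s) * (t - c) := by rw [← hy2]; ring
    rw [this]; simp only [hm, hn]; linear_combination hre
  have e4 : ρ * ((τ - α) * |w|) = |m * (|y| * (t - c)) - n * (|y| * (c - s))| := by
    have h5 : ρ * (w * (τ - α)) = (m * (t - c) - n * (c - s)) * y := by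
      simp only [hm, hn]; linear_combination -him
    have h6 : |ρ * (w * (τ - α))| = ρ * ((τ - α) * |w|) := by
      rw [abs_mul, abs_mul, abs_of_pos hρ, abs_of_pos (sub_pos.2 hατ)]; ring
    rw [← h6, h5, abs_mul]
    have : m * (|y| * (t - c)) - n * (|y| * (c - s)) = (m * (t - c) - n * (c - s)) * |y| := by ring
    rw [this, abs_mul, abs_abs]
  have key := cross_mul_le (m := m) (n := n) (mul_pos hy (sub_pos.2 hsc))
    (mul_pos hy (sub_pos.2 hct)) (by
      rw [← e2]; exact mul_pos hMp (mul_pos (by linarith) hy))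
  rw [← e1, ← e2, ← e3, ← e4] at key
  refine le_of_mul_le_mul_left ?_ (mul_pos hMp hρ)
  linarith

/-- The angle under which a segment is seen increases with the segment. -/
lemma segForm_lt_of_subset {α u₁ u₂ τ : ℝ} (h1 : α < u₁) (h12 : u₁ < u₂) (h2 : u₂ ≤ τ)
    {u : ℂ} (hu : u.im ≠ 0) :
    segForm α τ u * (u₂ - u₁) < segForm u₁ u₂ u * (τ - α) := by
  have h3 : 0 < τ - u₁ := by linarith
  have hy : 0 < u.im ^ 2 := by positivity
  -- The comparison passes through `[u₁, τ]`: multiplying by its length splits the difference into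
  -- one term for each removed piece, `[u₂, τ]` and `[α, u₁]`.
  have key : (segForm u₁ u₂ u * (τ - α) - segForm α τ u * (u₂ - u₁)) * (τ - u₁) =
      (τ - α) * (τ - u₂) * ((u.re - u₁) ^ 2 + u.im ^ 2) +
      (u₂ - u₁) * (u₁ - α) * ((u.re - τ) ^ 2 + u.im ^ 2) := by
    simp only [segForm]; ring
  have hpos : 0 < (segForm u₁ u₂ u * (τ - α) - segForm α τ u * (u₂ - u₁)) * (τ - u₁) := by
    rw [key]
    have a1 : 0 ≤ (τ - α) * (τ - u₂) * ((u.re - u₁) ^ 2 + u.im ^ 2) :=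
      mul_nonneg (mul_nonneg (by linarith) (by linarith)) (by positivity)
    have a2 : 0 < (u₂ - u₁) * (u₁ - α) * ((u.re - τ) ^ 2 + u.im ^ 2) :=
      mul_pos (mul_pos (by linarith) (by linarith)) (by positivity)
    linarith
  have := (pos_iff_pos_of_mul_pos hpos).2 h3
  linarith

/-- The fold does not increase the angle, shrinking `[α, τ]` to `[u₁, u₂]` strictly decreases it,
and the affine map carrying `[u₁, u₂]` onto `[s, t]` preserves it. Here `α` is the critical value of
the fold and `τ` the common image of `s` and `t`. -/
lemma segForm_lt_affine_fold {s c t α τ ρ A B u₁ u₂ : ℝ} (hsc : s < c) (hct : c < t) (hρ : 0 < ρ)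
    (h1 : α < u₁) (h12 : u₁ < u₂) (h2 : u₂ ≤ τ)
    (hA : A * u₁ + B = s ∧ A * u₂ + B = t ∨ A * u₁ + B = t ∧ A * u₂ + B = s)
    {z u : ℂ} (hz : z.im ≠ 0) (hu : u.im ≠ 0)
    (h : (ρ : ℂ) * ((u - α) * (starRingEnd ℂ) (u - τ)) =
      (z - c) ^ 2 * (starRingEnd ℂ) ((z - s) * (z - t))) :
    segForm s t z * |((A : ℂ) * u + B).im| < segForm s t (A * u + B) * |z.im| := by
  have hfold := segForm_fold_le hsc hct hρ (by linarith) hz h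
  have hsub := segForm_lt_of_subset h1 h12 h2 hu
  have hτα : 0 < τ - α := by linarith
  have him : ((A : ℂ) * u + B).im = A * u.im := by simp
  have hform : segForm s t (A * u + B) = |A| ^ 2 * segForm u₁ u₂ u := by
    rw [sq_abs]
    simp only [segForm]
    rcases hA with ⟨rfl, rfl⟩ | ⟨rfl, rfl⟩ <;> simp <;> ring
  have hts : t - s = |A| * (u₂ - u₁) := by
    rcases hA with ⟨rfl, rfl⟩ | ⟨rfl, rfl⟩
    · have : 0 < A := by
        by_contra hn
        nlinarith
      rw [abs_of_pos this]; ring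
    · have : A < 0 := by
        by_contra hn
        nlinarith
      rw [abs_of_neg this]; ring
  have hAp : 0 < |A| := by
    by_contra hn
    have : t - s ≤ 0 := by rw [hts]; nlinarith
    linarith
  rw [him, abs_mul, hform]
  have hy : 0 < |z.im| := abs_pos.2 hz
  rw [hts] at hfold
  have h3 := mul_lt_mul_of_pos_right hsub (mul_pos (mul_pos hAp hAp) hy)
  have h4 := mul_le_mul_of_nonneg_left hfold hAp.le
  refine lt_of_mul_lt_mul_left ?_ hτα.le
  nlinarith

lemma isCompact_ofReal_preimage {K : Set ℂ} (hK : IsCompact K) :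
    IsCompact ((fun x : ℝ => (x : ℂ)) ⁻¹' K) :=
  Complex.isometry_ofReal.isClosedEmbedding.isCompact_preimage hK

lemma ofReal_re_eq {z : ℂ} (h : z.im = 0) : (z.re : ℂ) = z := Complex.ext (by simp) (by simp [h])

/-! ### Quadratic polynomials -/

/-- A real quadratic polynomial whose critical point escapes: the filled Julia set has no real
point or only real points. -/
lemma polynomial_dichotomy {c : ℝ} {K : Set ℂ} (hK : IsCompact K)
    (hmem : ∀ z : ℂ, z ^ 2 + c ∈ K ↔ z ∈ K)
    (hinv : ∀ a b : ℝ, (∀ x ∈ Set.Icc a b, x ^ 2 + c ∈ Set.Icc a b) →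
      ∀ x ∈ Set.Icc a b, (x : ℂ) ∈ K)
    (h0 : (0 : ℂ) ∉ K) : (∀ x : ℝ, (x : ℂ) ∉ K) ∨ ∀ z ∈ K, z.im = 0 := by
  by_cases hne : ∀ x : ℝ, (x : ℂ) ∉ K
  · exact Or.inl hne
  right
  push Not at hne
  have hmemR : ∀ x : ℝ, ((x ^ 2 + c : ℝ) : ℂ) ∈ K ↔ (x : ℂ) ∈ K := by
    intro x; rw [← hmem (x : ℂ)]; push_cast; rfl
  have hneg : ∀ x : ℝ, (x : ℂ) ∈ K → ((-x : ℝ) : ℂ) ∈ K := by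
    intro x hx
    rw [← hmemR, neg_sq, hmemR]; exact hx
  obtain ⟨T, hT⟩ := (isCompact_ofReal_preimage hK).exists_isGreatest hne
  have hTK : (T : ℂ) ∈ K := hT.1
  have hle : ∀ x : ℝ, (x : ℂ) ∈ K → x ≤ T := fun x hx => hT.2 hx
  have hge : ∀ x : ℝ, (x : ℂ) ∈ K → -T ≤ x := fun x hx => by linarith [hle _ (hneg x hx)]
  have hT0 : 0 < T := by
    rcases (show 0 ≤ T by linarith [hge T hTK]).lt_or_eq with h | h
    · exact h
    · rw [← h] at hTK; exact absurd hTK (by simpa using h0)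
  -- If `T ^ 2 + c < T`, the preimage `√(T - c)` of `T` would be a real point of `K` beyond `T`.
  have hfix : T ^ 2 + c = T := by
    refine le_antisymm (hle _ ((hmemR T).2 hTK)) ?_
    by_contra! hlt
    have hsq : √(T - c) ^ 2 = T - c := Real.sq_sqrt (by nlinarith)
    have h1 := hle _ ((hmemR (√(T - c))).1 (by rw [hsq, sub_add_cancel]; exact hTK))
    nlinarith [Real.sqrt_nonneg (T - c)]
  -- Otherwise `[-T, T]` is invariant, so the critical point `0` would not escape.
  have hcT : c < -T := by
    by_contra! hcT
    have := hinv (-T) T (fun x hx => ⟨by nlinarith [sq_nonneg x], by nlinarith [hx.1, hx.2]⟩) 0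
      ⟨by linarith, hT0.le⟩
    exact h0 (by simpa using this)
  -- Enlarging `T` slightly puts the real points of `K` in an open interval that still excludes the
  -- critical value `c`.
  obtain ⟨S, hTS, hSc⟩ := exists_between (show T < -c by linarith)
  have hS0 : 0 < S := by linarith
  have hT2 : 2 < T := by nlinarith
  have hSq : S - c ≤ S ^ 2 := by
    nlinarith [mul_pos (show 0 < S - T by linarith) (show 0 < S + T - 1 by linarith)]
  have hreal : ∀ x : ℝ, (x : ℂ) ∈ K → -S < x ∧ x < S := fun x hx =>
    ⟨by linarith [hge x hx], by linarith [hle x hx]⟩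
  refine im_eq_zero_of_angle_decreasing hK (f := fun z => z ^ 2 + c) (fun z hz => (hmem z).2 hz)
    hreal fun z hz him => ?_
  -- A nonreal `z` with real square is purely imaginary, so its image is at most `c < -S`, outside
  -- the range of real points of `K`.
  have hu : (z ^ 2).im ≠ 0 := by
    intro hu
    have h1 : (((z ^ 2).re + c : ℝ) : ℂ) = z ^ 2 + c := by
      push_cast; rw [ofReal_re_eq hu]
    have h2 := hreal _ (by rw [h1]; exact (hmem z).2 hz)
    have h3 : (z ^ 2).re = z.re ^ 2 - z.im ^ 2 := by simp [pow_two]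
    have h4 : z.re = 0 := by
      have : (z ^ 2).im = 2 * (z.re * z.im) := by simp [pow_two]; ring
      rw [this] at hu
      simpa [him] using hu
    rw [h3, h4] at h2
    nlinarith [sq_nonneg z.im]
  refine ⟨by simpa using hu, ?_⟩
  have := segForm_lt_affine_fold (s := -S) (c := 0) (t := S) (α := 0) (τ := S ^ 2) (ρ := 1) (A := 1)
    (B := c) (u₁ := -S - c) (u₂ := S - c) (z := z) (u := z ^ 2) (by linarith) hS0 one_pos
    (by linarith) (by linarith) hSq (Or.inl ⟨by ring, by ring⟩) him hu
    (by simp only [map_sub, map_mul, map_pow, Complex.conj_ofReal]; push_cast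
        ring)
  simpa using this

/-! ### Maps with a simple pole and real critical points -/

/-- The map `z ↦ A (z + 1 / z) + B`. -/
def joukowski (A B : ℝ) (z : ℂ) : ℂ := A * (z + z⁻¹) + B

/-- The map `x ↦ A (x + 1 / x) + B` on the real line. -/
def realJoukowski (A B : ℝ) (x : ℝ) : ℝ := A * (x + x⁻¹) + B

lemma joukowski_ofReal (A B x : ℝ) : joukowski A B x = realJoukowski A B x := by
  simp [joukowski, realJoukowski]

/-- The properties that are used of the set of points not escaping to `∞` under `joukowski A B`. -/
structure IsTrapped (A B : ℝ) (K : Set ℂ) : Prop where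
  isCompact : IsCompact K
  zero_notMem : (0 : ℂ) ∉ K
  mem_iff : ∀ z : ℂ, z ≠ 0 → (joukowski A B z ∈ K ↔ z ∈ K)
  interval : ∀ a b : ℝ, (0 < a ∨ b < 0) →
    (∀ x ∈ Set.Icc a b, realJoukowski A B x ∈ Set.Icc a b) → ∀ x ∈ Set.Icc a b, (x : ℂ) ∈ K
  one_notMem : (1 : ℂ) ∉ K
  neg_one_notMem : (-1 : ℂ) ∉ K

namespace IsTrapped

variable {A B : ℝ} {K : Set ℂ}

/-- Conjugation by `z ↦ -z` replaces `B` by `-B`; it reduces statements about least or negative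
points to greatest or positive ones. -/
lemma reflect (h : IsTrapped A B K) : IsTrapped A (-B) {z | -z ∈ K} where
  isCompact := (Homeomorph.neg ℂ).isClosedEmbedding.isCompact_preimage h.isCompact
  zero_notMem := by simpa using h.zero_notMem
  mem_iff z hz := by
    rw [Set.mem_ofPred_eq, Set.mem_ofPred_eq, ← h.mem_iff (-z) (neg_ne_zero.2 hz)]
    have : -joukowski A (-B) z = joukowski A B (-z) := by
      simp only [joukowski, inv_neg]; push_cast; ring
    rw [this]
  interval a b hab hinv x hx := by
    have := h.interval (-b) (-a) (by rcases hab with h | h <;> [right; left] <;> linarith)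
      (fun y hy => by
        obtain ⟨h1, h2⟩ := hinv (-y) ⟨by linarith [hy.2], by linarith [hy.1]⟩
        have : realJoukowski A (-B) (-y) = -realJoukowski A B y := by
          simp only [realJoukowski, inv_neg]; ring
        rw [this] at h1 h2
        exact ⟨by linarith, by linarith⟩) (-x) ⟨by linarith [hx.2], by linarith [hx.1]⟩
    simpa using this
  one_notMem := by simpa using h.neg_one_notMem
  neg_one_notMem := by simpa using h.one_notMem

lemma ofReal_ne_zero (h : IsTrapped A B K) {x : ℝ} (hx : (x : ℂ) ∈ K) : x ≠ 0 := by
  rintro rfl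
  exact h.zero_notMem (by simpa using hx)

lemma real_mem_iff (h : IsTrapped A B K) {x : ℝ} (hx : x ≠ 0) :
    ((realJoukowski A B x : ℝ) : ℂ) ∈ K ↔ (x : ℂ) ∈ K := by
  rw [← h.mem_iff (x : ℂ) (by exact_mod_cast hx), joukowski_ofReal]

lemma inv_mem (h : IsTrapped A B K) {x : ℝ} (hx : (x : ℂ) ∈ K) : ((x⁻¹ : ℝ) : ℂ) ∈ K := by
  have h0 := h.ofReal_ne_zero hx
  rw [← h.real_mem_iff (inv_ne_zero h0)]
  have : realJoukowski A B x⁻¹ = realJoukowski A B x := by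
    simp only [realJoukowski, inv_inv]; ring
  rw [this, h.real_mem_iff h0]
  exact hx

lemma continuousOn_realJoukowski (A B : ℝ) {a b : ℝ} (ha : 0 < a) :
    ContinuousOn (realJoukowski A B) (Set.Icc a b) := by
  unfold realJoukowski
  refine (continuousOn_const.mul (continuousOn_id.add (continuousOn_id.inv₀ ?_))).add
    continuousOn_const
  intro x hx
  exact (ha.trans_le hx.1).ne'

lemma apply_greatest_of_pos (h : IsTrapped A B K) (hA : 1 < A) {t : ℝ} (ht : 0 < t)
    (htK : (t : ℂ) ∈ K) (hle : ∀ x : ℝ, (x : ℂ) ∈ K → x ≤ t) : realJoukowski A B t = t := by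
  refine le_antisymm (hle _ ((h.real_mem_iff ht.ne').2 htK)) ?_
  by_contra! hlt
  -- At `X = t + |t - B|` one has `A X + B ≥ X + B ≥ 2 t`, so the value `t` is taken at some point
  -- beyond `t`.
  have hX : t ≤ realJoukowski A B (t + |t - B|) := by
    have h1 : 0 < t + |t - B| := by positivity
    have h2 : 0 < A * (t + |t - B|)⁻¹ := by positivity
    simp only [realJoukowski]
    nlinarith [le_abs_self (t - B), abs_nonneg (t - B)]
  obtain ⟨x, hx, hxt⟩ := intermediate_value_Icc (show t ≤ t + |t - B| by simp)
    (continuousOn_realJoukowski A B ht) ⟨hlt.le, hX⟩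
  have hxK := hle x ((h.real_mem_iff (ht.trans_le hx.1).ne').1 (by rw [hxt]; exact htK))
  have : x = t := le_antisymm hxK hx.1
  rw [this] at hxt
  linarith

lemma apply_greatest_of_neg (h : IsTrapped A B K) (hA : A < -1) {s t : ℝ} (ht : 0 < t)
    (htK : (t : ℂ) ∈ K) (hle : ∀ x : ℝ, (x : ℂ) ∈ K → x ≤ t) (hsK : (s : ℂ) ∈ K)
    (hge : ∀ x : ℝ, (x : ℂ) ∈ K → s ≤ x) : realJoukowski A B t = s := by
  refine le_antisymm ?_ (hge _ ((h.real_mem_iff ht.ne').2 htK))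
  by_contra! hlt
  have hX : realJoukowski A B (t + |s - B|) ≤ s := by
    have h1 : 0 < t + |s - B| := by positivity
    have h2 : A * (t + |s - B|)⁻¹ < 0 := mul_neg_of_neg_of_pos (by linarith) (by positivity)
    simp only [realJoukowski]
    nlinarith [neg_abs_le (s - B), abs_nonneg (s - B)]
  obtain ⟨x, hx, hxt⟩ := intermediate_value_Icc' (show t ≤ t + |s - B| by simp)
    (continuousOn_realJoukowski A B ht) ⟨hX, hlt.le⟩
  have hxK := hle x ((h.real_mem_iff (ht.trans_le hx.1).ne').1 (by rw [hxt]; exact hsK))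
  have : x = t := le_antisymm hxK hx.1
  rw [this] at hxt
  linarith

/-- For `A > 1` both extreme points are fixed, so `s t = A / (A - 1)`; for `A < -1` they are
exchanged, so `s t = A / (A + 1)`. Both values are positive. -/
lemma not_neg_pos (h : IsTrapped A B K) (hA : 1 < |A|) {s t : ℝ} (hs : s < 0) (ht : 0 < t)
    (htK : (t : ℂ) ∈ K) (hle : ∀ x : ℝ, (x : ℂ) ∈ K → x ≤ t) (hsK : (s : ℂ) ∈ K)
    (hge : ∀ x : ℝ, (x : ℂ) ∈ K → s ≤ x) : False := by
  have hsK' : ((-s : ℝ) : ℂ) ∈ {z | -z ∈ K} := by simpa using hsK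
  have hle' : ∀ x : ℝ, (x : ℂ) ∈ {z | -z ∈ K} → x ≤ -s := fun x hx => by
    have := hge (-x) (by simpa using hx)
    linarith
  have hst : s * t < 0 := mul_neg_of_neg_of_pos hs ht
  have hrefl : realJoukowski A (-B) (-s) = -realJoukowski A B s := by
    simp only [realJoukowski, inv_neg]; ring
  rcases lt_abs.1 hA with hA | hA
  · have h1 := h.apply_greatest_of_pos hA ht htK hle
    have h2 := h.reflect.apply_greatest_of_pos hA (neg_pos.2 hs) hsK' hle'
    rw [hrefl, neg_inj] at h2
    simp only [realJoukowski] at h1 h2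
    have h3 : (t - s) * (A * (s * t - 1) - s * t) = 0 := by
      have hs' := hs.ne
      have ht' := ht.ne'
      field_simp at h1 h2
      linear_combination s * h1 - t * h2
    rcases mul_eq_zero.1 h3 with h3 | h3
    · linarith
    · nlinarith
  · have h1 := h.apply_greatest_of_neg (by linarith) ht htK hle hsK hge
    have h2 := h.reflect.apply_greatest_of_neg (by linarith) (neg_pos.2 hs) hsK' hle'
      (s := -t) (by simpa using htK) (fun x hx => by
        have := hle (-x) (by simpa using hx)
        linarith)
    rw [hrefl, neg_inj] at h2
    simp only [realJoukowski] at h1 h2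
    have h3 : (t - s) * (A * (s * t - 1) + s * t) = 0 := by
      have hs' := hs.ne
      have ht' := ht.ne'
      field_simp at h1 h2
      linear_combination s * h1 - t * h2
    rcases mul_eq_zero.1 h3 with h3 | h3
    · linarith
    · nlinarith

lemma add_inv_mono {x y : ℝ} (hx : 1 ≤ x) (hxy : x ≤ y) : x + x⁻¹ ≤ y + y⁻¹ := by
  have hx0 : 0 < x := by linarith
  have hy0 : 0 < y := by linarith
  have : y + y⁻¹ - (x + x⁻¹) = (y - x) * (x * y - 1) / (x * y) := by field_simp; ring
  have h2 : 0 ≤ (y - x) * (x * y - 1) / (x * y) :=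
    div_nonneg (mul_nonneg (by linarith) (by nlinarith)) (by positivity)
  linarith

lemma two_le_add_inv {x : ℝ} (hx : 0 < x) : 2 ≤ x + x⁻¹ := by
  have : x + x⁻¹ - 2 = (x - 1) ^ 2 / x := by field_simp; ring
  have h2 : 0 ≤ (x - 1) ^ 2 / x := by positivity
  linarith

lemma add_inv_le_of_mem {x T : ℝ} (hT : 1 ≤ T) (hx : x ∈ Set.Icc T⁻¹ T) :
    x + x⁻¹ ≤ T + T⁻¹ := by
  have hT0 : 0 < T := by linarith
  have hx0 : 0 < x := (inv_pos.2 hT0).trans_le hx.1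
  rcases le_total 1 x with h | h
  · exact add_inv_mono h hx.2
  · have := add_inv_mono (one_le_inv₀ hx0 |>.2 h) (inv_le_of_inv_le₀ hT0 hx.1)
    rw [inv_inv] at this
    linarith

/-- The step of the argument that passes from the real line to the plane. -/
lemma im_eq_zero_of_slit (h : IsTrapped A B K) {S u₁ u₂ : ℝ} (hS : 1 < S)
    (hreal : ∀ x : ℝ, (x : ℂ) ∈ K → S⁻¹ < x ∧ x < S) (h1 : 2 < u₁) (h12 : u₁ < u₂)
    (h2 : u₂ ≤ S + S⁻¹)
    (hu : A * u₁ + B = S⁻¹ ∧ A * u₂ + B = S ∨ A * u₁ + B = S ∧ A * u₂ + B = S⁻¹) :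
    ∀ z ∈ K, z.im = 0 := by
  have hS0 : 0 < S := by linarith
  refine im_eq_zero_of_angle_decreasing h.isCompact (f := joukowski A B) (fun z hz => ?_)
    hreal fun z hz him => ?_
  · exact (h.mem_iff z (fun h0 => h.zero_notMem (h0 ▸ hz))).2 hz
  have hz0 : z ≠ 0 := fun h0 => h.zero_notMem (h0 ▸ hz)
  have hn : 0 < Complex.normSq z := Complex.normSq_pos.2 hz0
  -- If `z + 1 / z` is real with `z` nonreal, then `|z| = 1` and `z + 1 / z ≤ 2`; but its affine
  -- image is a real point of `K`, which forces it above `u₁ > 2`.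
  have huim : (z + z⁻¹).im ≠ 0 := by
    intro hu0
    have h3 : ((A * (z + z⁻¹).re + B : ℝ) : ℂ) = joukowski A B z := by
      rw [joukowski]; push_cast; rw [ofReal_re_eq hu0]
    obtain ⟨h4, h5⟩ := hreal _ (by rw [h3]; exact (h.mem_iff z hz0).2 hz)
    have h6 : u₁ < (z + z⁻¹).re := by
      rcases hu with ⟨e1, e2⟩ | ⟨e1, e2⟩
      · have hA : 0 < A := by
          by_contra hn; nlinarith
        nlinarith
      · have hA : A < 0 := by
          by_contra hn; nlinarith
        nlinarith
    have h7 : Complex.normSq z = 1 := by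
      rw [Complex.add_im, Complex.inv_im] at hu0
      field_simp at hu0
      have : z.im * (Complex.normSq z - 1) = 0 := by linarith
      rcases mul_eq_zero.1 this with h | h
      · exact absurd h him
      · linarith
    rw [Complex.add_re, Complex.inv_re, h7, div_one] at h6
    rw [Complex.normSq_apply] at h7
    nlinarith [sq_nonneg z.im]
  refine ⟨?_, ?_⟩
  · have hA : A ≠ 0 := by
      rintro rfl
      rcases hu with ⟨e1, e2⟩ | ⟨e1, e2⟩ <;> linarith [inv_lt_one_of_one_lt₀ hS]
    simpa [joukowski, hA] using huim
  -- With `u = z + 1 / z`, the fold identity comes from `u - 2 = (z - 1) ^ 2 / z` and `u - (S + 1 /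
  -- S) = (z - S) (z - 1 / S) / z`.
  · refine segForm_lt_affine_fold (c := 1) (α := 2) (τ := S + S⁻¹) (ρ := Complex.normSq z)
      (inv_lt_one_of_one_lt₀ hS) hS hn h1 h12 h2 hu him huim ?_
    have hSc : (S : ℂ) ≠ 0 := by exact_mod_cast hS0.ne'
    have hzc : (starRingEnd ℂ) z ≠ 0 := by simpa using hz0
    rw [Complex.normSq_eq_conj_mul_self]
    simp only [map_sub, map_mul, map_add, map_inv₀, Complex.conj_ofReal]
    push_cast
    field_simp
    ring

lemma dichotomy_of_pos (h : IsTrapped A B K) (hA : 1 < |A|) {t : ℝ} (ht : 0 < t)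
    (htK : (t : ℂ) ∈ K) (hle : ∀ x : ℝ, (x : ℂ) ∈ K → x ≤ t)
    (hpos : ∀ x : ℝ, (x : ℂ) ∈ K → 0 < x) : ∀ z ∈ K, z.im = 0 := by
  have ht1 : 1 < t := by
    have h1 : t⁻¹ ≤ t := hle _ (h.inv_mem htK)
    have h2 : 1 ≤ t := by
      by_contra! hlt
      linarith [(one_lt_inv₀ ht).2 hlt]
    rcases h2.lt_or_eq with h3 | h3
    · exact h3
    · rw [← h3] at htK; exact absurd (by simpa using htK) h.one_notMem
  have hge : ∀ x : ℝ, (x : ℂ) ∈ K → t⁻¹ ≤ x := fun x hx =>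
    inv_le_of_inv_le₀ (hpos x hx) (hle _ (h.inv_mem hx))
  have hreal : ∀ S, t < S → ∀ x : ℝ, (x : ℂ) ∈ K → S⁻¹ < x ∧ x < S := fun S hS x hx =>
    ⟨(inv_strictAnti₀ ht hS).trans_le (hge x hx), (hle x hx).trans_lt hS⟩
  have hti : 0 < t⁻¹ := inv_pos.2 ht
  have hti1 : t⁻¹ < 1 := inv_lt_one_of_one_lt₀ ht1
  rcases lt_abs.1 hA with hA | hA
  · have hfix := h.apply_greatest_of_pos hA ht htK hle
    -- Otherwise `[1 / t, t]` is invariant and the critical point `1` is trapped.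
    have hcrit : B + 2 * A < t⁻¹ := by
      by_contra! hcon
      refine h.one_notMem ?_
      have := h.interval t⁻¹ t (Or.inl hti) (fun x hx => ?_) 1 ⟨hti1.le, ht1.le⟩
      · simpa using this
      · rw [← hfix]
        simp only [realJoukowski] at hfix ⊢
        rw [hfix]
        have e1 := two_le_add_inv (hti.trans_le hx.1)
        have e2 := add_inv_le_of_mem ht1.le hx
        constructor <;> nlinarith
    obtain ⟨S, hS, hSc⟩ : ∃ S, t < S ∧ B + 2 * A < S⁻¹ := by
      have hc : ContinuousAt (fun S : ℝ => S⁻¹) t := continuousAt_inv₀ ht.ne'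
      have := (hc.eventually (lt_mem_nhds hcrit)).filter_mono (nhdsWithin_le_nhds (s := Set.Ioi t))
      obtain ⟨S, h1, h2⟩ := (this.and self_mem_nhdsWithin).exists
      exact ⟨S, h2, h1⟩
    have hS1 : 1 < S := ht1.trans hS
    have hS0 : 0 < S := by linarith
    -- Otherwise `[t, S]` is invariant, contradicting the maximality of `t`.
    have hSS : S ≤ realJoukowski A B S := by
      by_contra! hcon
      have := h.interval t S (Or.inl ht) (fun x hx => ?_) S ⟨hS.le, le_rfl⟩
      · linarith [hle S this]
      · simp only [realJoukowski] at hfix hcon ⊢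
        have e1 := add_inv_mono ht1.le hx.1
        have e2 := add_inv_mono (ht1.le.trans hx.1) hx.2
        constructor <;> nlinarith
    have hA0 : 0 < A := by linarith
    refine h.im_eq_zero_of_slit hS1 (hreal S hS) (u₁ := (S⁻¹ - B) / A) (u₂ := (S - B) / A) ?_ ?_ ?_
      (Or.inl ⟨by field_simp; ring, by field_simp; ring⟩)
    · rw [lt_div_iff₀ hA0]; linarith
    · gcongr
      linarith [inv_lt_one_of_one_lt₀ hS1]
    · rw [div_le_iff₀ hA0]
      simp only [realJoukowski] at hSS
      linarith
  · have hfix := h.apply_greatest_of_neg (by linarith) ht htK hle (h.inv_mem htK) hge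
    have hcrit : t < B + 2 * A := by
      by_contra! hcon
      refine h.one_notMem ?_
      have := h.interval t⁻¹ t (Or.inl hti) (fun x hx => ?_) 1 ⟨hti1.le, ht1.le⟩
      · simpa using this
      · simp only [realJoukowski] at hfix ⊢
        have e1 := two_le_add_inv (hti.trans_le hx.1)
        have e2 := add_inv_le_of_mem ht1.le hx
        constructor <;> nlinarith
    obtain ⟨S, hS, hSc⟩ := exists_between hcrit
    have hS1 : 1 < S := ht1.trans hS
    have hS0 : 0 < S := by linarith
    have hSi : S⁻¹ < t⁻¹ := inv_strictAnti₀ ht hS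
    -- Otherwise `[1 / S, 1 / t]` is invariant and contains real points of `K` below the least one,
    -- `1 / t`.
    have hSS : realJoukowski A B S ≤ S⁻¹ := by
      by_contra! hcon
      have hSi0 : 0 < S⁻¹ := inv_pos.2 hS0
      have := h.interval S⁻¹ t⁻¹ (Or.inl hSi0) (fun x hx => ?_) S⁻¹ ⟨le_rfl, hSi.le⟩
      · linarith [hge _ this]
      · simp only [realJoukowski] at hfix hcon ⊢
        have hx0 : 0 < x := hSi0.trans_le hx.1
        have e1 := add_inv_le_of_mem hS1.le ⟨hx.1, by linarith [hx.2]⟩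
        have e2 := add_inv_mono ht1.le ((le_inv_comm₀ hx0 ht).1 hx.2)
        rw [inv_inv] at e2
        constructor <;> nlinarith
    have hA0 : 0 < -A := by linarith
    have hA1 : A ≠ 0 := by linarith
    refine h.im_eq_zero_of_slit hS1 (hreal S hS) (u₁ := (B - S) / -A) (u₂ := (B - S⁻¹) / -A)
      ?_ ?_ ?_ (Or.inr ⟨by field_simp; ring, by field_simp; ring⟩)
    · rw [lt_div_iff₀ hA0]; linarith
    · gcongr
      linarith [inv_lt_one_of_one_lt₀ hS1]
    · rw [div_le_iff₀ hA0]
      simp only [realJoukowski] at hSS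
      linarith

/-- The trapped set of `z ↦ A (z + 1 / z) + B` has no real point or only real points. -/
lemma dichotomy (h : IsTrapped A B K) (hA : 1 < |A|) :
    (∀ x : ℝ, (x : ℂ) ∉ K) ∨ ∀ z ∈ K, z.im = 0 := by
  by_cases hne : ∀ x : ℝ, (x : ℂ) ∉ K
  · exact Or.inl hne
  right
  push Not at hne
  obtain ⟨t, ht⟩ := (isCompact_ofReal_preimage h.isCompact).exists_isGreatest hne
  obtain ⟨s, hs⟩ := (isCompact_ofReal_preimage h.isCompact).exists_isLeast hne
  have hle : ∀ x : ℝ, (x : ℂ) ∈ K → x ≤ t := fun x hx => ht.2 hx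
  have hge : ∀ x : ℝ, (x : ℂ) ∈ K → s ≤ x := fun x hx => hs.2 hx
  rcases (h.ofReal_ne_zero hs.1).lt_or_gt with hs0 | hs0
  · rcases (h.ofReal_ne_zero ht.1).lt_or_gt with ht0 | ht0
    · intro z hz
      have := h.reflect.dichotomy_of_pos hA (t := -s) (by linarith) (by simpa using hs.1)
        (fun x hx => by linarith [hge (-x) (by simpa using hx)])
        (fun x hx => by linarith [hle (-x) (by simpa using hx)]) (-z) (by simpa using hz)
      simpa using this
    · exact (h.not_neg_pos hA hs0 ht0 ht.1 hle hs.1 hge).elim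
  · exact h.dichotomy_of_pos hA (hs0.trans_le (hge t ht.1)) ht.1 hle fun x hx =>
      hs0.trans_le (hge x hx)

end IsTrapped

/-! ### Real Möbius transformations and conjugation -/

/-- The real Möbius transformation `z ↦ (α z + β) / (γ z + δ)` of the Riemann sphere. -/
def moebius (α β γ δ : ℝ) : Sphere → Sphere
  | OnePoint.some z => homog (α * z + β) (γ * z + δ)
  | OnePoint.infty => homog α γ

section Moebius

variable {α β γ δ : ℝ}

lemma moebius_coe (z : ℂ) :
    moebius α β γ δ (z : Sphere) = homog (α * z + β) (γ * z + δ) := rfl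

lemma moebius_infty : moebius α β γ δ OnePoint.infty = homog α γ := rfl

lemma moebius_homog {x y : ℂ} (h : x ≠ 0 ∨ y ≠ 0) :
    moebius α β γ δ (homog x y) = homog (α * x + β * y) (γ * x + δ * y) := by
  by_cases hy : y = 0
  · have hx : x ≠ 0 := h.resolve_right (by simp [hy])
    rw [hy, homog_zero, moebius_infty, ← homog_mul hx]
    congr 1 <;> ring
  · rw [homog_of_ne _ hy, moebius_coe, ← homog_mul hy]
    congr 1 <;> field_simp

lemma moebius_ne_zero (h : α * δ - β * γ ≠ 0) {x y : ℂ} (hxy : x ≠ 0 ∨ y ≠ 0) :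
    (α * x + β * y : ℂ) ≠ 0 ∨ (γ * x + δ * y : ℂ) ≠ 0 := by
  by_contra! hcon
  obtain ⟨h1, h2⟩ := hcon
  have hc : (α * δ - β * γ : ℂ) ≠ 0 := by exact_mod_cast h
  have hx : (α * δ - β * γ : ℂ) * x = 0 := by linear_combination δ * h1 - β * h2
  have hy : (α * δ - β * γ : ℂ) * y = 0 := by linear_combination α * h2 - γ * h1
  rcases hxy with hxy | hxy
  · exact hxy ((mul_eq_zero.1 hx).resolve_left hc)
  · exact hxy ((mul_eq_zero.1 hy).resolve_left hc)

lemma continuous_moebius (h : α * δ - β * γ ≠ 0) : Continuous (moebius α β γ δ) :=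
  continuous_of_homog (X := fun v => α * v.1 + β * v.2) (Y := fun v => γ * v.1 + δ * v.2)
    (by fun_prop) (by fun_prop) (fun _ _ => moebius_ne_zero h) fun _ _ => moebius_homog

lemma det_adjugate_ne_zero (h : α * δ - β * γ ≠ 0) : δ * α - -β * -γ ≠ 0 := by
  intro h0; apply h; linarith

lemma moebius_leftInverse (h : α * δ - β * γ ≠ 0) :
    Function.LeftInverse (moebius δ (-β) (-γ) α) (moebius α β γ δ) := by
  intro z
  obtain ⟨x, y, hxy, rfl⟩ := exists_homog z
  have hc : (α * δ - β * γ : ℂ) ≠ 0 := by exact_mod_cast h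
  rw [moebius_homog hxy, moebius_homog (moebius_ne_zero h hxy), ← homog_mul hc x y]
  push_cast
  congr 1 <;> ring

lemma moebius_rightInverse (h : α * δ - β * γ ≠ 0) :
    Function.RightInverse (moebius δ (-β) (-γ) α) (moebius α β γ δ) := by
  have := moebius_leftInverse (det_adjugate_ne_zero h)
  rwa [neg_neg, neg_neg] at this

lemma moebius_mem_realCircle_iff (h : α * δ - β * γ ≠ 0) {z : Sphere} :
    moebius α β γ δ z ∈ realCircle ↔ z ∈ realCircle := by
  obtain ⟨x, y, hxy, rfl⟩ := exists_homog z
  rw [moebius_homog hxy, homog_mem_realCircle, homog_mem_realCircle]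
  have : ((α * x + β * y) * (starRingEnd ℂ) (γ * x + δ * y)).im =
      (α * δ - β * γ) * (x * (starRingEnd ℂ) y).im := by
    simp; ring
  rw [this, mul_eq_zero, or_iff_right h]

end Moebius

/-- The basin of `p` contains the real circle or its complement. -/
def BasinDichotomy (F : Sphere → Sphere) (p : Sphere) : Prop :=
  realCircle ⊆ basin F p ∨ realCircleᶜ ⊆ basin F p

namespace QuadPair

/-- The situation of the escape locus, in a form that is invariant under real Möbius
transformations. -/
structure Escapes (q : QuadPair) (p : Sphere) : Prop where
  isReduced : q.IsReduced
  fixed : q.toMap p = p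
  attracting : UniformlyAttracting q.toMap p
  critical : q.CriticalInBasin p

section Conjugation

variable {q q' : QuadPair} {α β γ δ κ : ℝ} {p : Sphere}

lemma semiconj_moebius (hq : q.IsReduced) (hκ : κ ≠ 0) (hΔ : α * δ - β * γ ≠ 0)
    (hnum : ∀ x y : ℂ, κ * q'.num (α * x + β * y) (γ * x + δ * y) =
      α * q.num x y + β * q.den x y)
    (hden : ∀ x y : ℂ, κ * q'.den (α * x + β * y) (γ * x + δ * y) =
      γ * q.num x y + δ * q.den x y) :
    Function.Semiconj (moebius α β γ δ) q.toMap q'.toMap := by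
  intro z
  obtain ⟨x, y, hxy, rfl⟩ := exists_homog z
  have hκ' : (κ : ℂ) ≠ 0 := by exact_mod_cast hκ
  rw [toMap_homog _ hxy, moebius_homog (hq x y hxy), moebius_homog hxy,
    toMap_homog _ (moebius_ne_zero hΔ hxy), ← hnum, ← hden, homog_mul hκ']

/-- Uniform attraction is topological, so no derivative has to be transported; critical points are
pulled back through the zeros of the Jacobian form. -/
lemma Escapes.conjugate (h : q.Escapes p) (hκ : κ ≠ 0) (hΔ : α * δ - β * γ ≠ 0)
    (hnum : ∀ x y : ℂ, κ * q'.num (α * x + β * y) (γ * x + δ * y) =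
      α * q.num x y + β * q.den x y)
    (hden : ∀ x y : ℂ, κ * q'.den (α * x + β * y) (γ * x + δ * y) =
      γ * q.num x y + δ * q.den x y)
    (hjac : ∀ x y : ℂ, q'.jac (α * x + β * y) (γ * x + δ * y) = 0 → q.jac x y = 0) :
    q'.Escapes (moebius α β γ δ p) ∧
      (BasinDichotomy q'.toMap (moebius α β γ δ p) → BasinDichotomy q.toMap p) := by
  have hsemi := semiconj_moebius h.isReduced hκ hΔ hnum hden
  have hc := continuous_moebius hΔ
  have hc' := continuous_moebius (det_adjugate_ne_zero hΔ)
  have hl := moebius_leftInverse hΔ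
  have hr := moebius_rightInverse hΔ
  have hsemi' := hsemi.inverse_left hl hr
  have hΔ' : (α * δ - β * γ : ℂ) ≠ 0 := by exact_mod_cast hΔ
  have hsurj : ∀ X Y : ℂ, X ≠ 0 ∨ Y ≠ 0 → ∃ x y : ℂ, (x ≠ 0 ∨ y ≠ 0) ∧
      α * x + β * y = X ∧ γ * x + δ * y = Y := by
    intro X Y hXY
    have e1 : (α * ((δ * X - β * Y) / (α * δ - β * γ)) +
        β * ((α * Y - γ * X) / (α * δ - β * γ)) : ℂ) = X := by
      rw [← mul_div_assoc, ← mul_div_assoc, ← add_div, div_eq_iff hΔ']; ring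
    have e2 : (γ * ((δ * X - β * Y) / (α * δ - β * γ)) +
        δ * ((α * Y - γ * X) / (α * δ - β * γ)) : ℂ) = Y := by
      rw [← mul_div_assoc, ← mul_div_assoc, ← add_div, div_eq_iff hΔ']; ring
    refine ⟨_, _, ?_, e1, e2⟩
    by_contra! hcon
    rw [hcon.1, hcon.2] at e1 e2
    simp at e1 e2
    rcases hXY with h | h
    · exact h e1.symm
    · exact h e2.symm
  refine ⟨⟨?_, ?_, ?_, ?_⟩, ?_⟩
  · intro X Y hXY
    obtain ⟨x, y, hxy, rfl, rfl⟩ := hsurj X Y hXY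
    rcases moebius_ne_zero hΔ (h.isReduced x y hxy) with h1 | h1
    · rw [← hnum] at h1; exact Or.inl (right_ne_zero_of_mul h1)
    · rw [← hden] at h1; exact Or.inr (right_ne_zero_of_mul h1)
  · rw [← hsemi, h.fixed]
  · obtain ⟨U, hU, hV⟩ := h.attracting
    refine ⟨moebius δ (-β) (-γ) α ⁻¹' U, hc'.continuousAt (by rwa [hl p]), fun V hVp => ?_⟩
    filter_upwards [hV _ (hc.continuousAt hVp)] with n hn z hz
    have := hn hz
    rwa [Set.mem_preimage, hsemi.iterate_right n, hr z] at this
  · intro X Y hXY hj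
    obtain ⟨x, y, hxy, rfl, rfl⟩ := hsurj X Y hXY
    rw [← moebius_homog hxy]
    exact basin_semiconj hc hsemi (h.critical x y hxy (hjac x y hj))
  · have key : ∀ z, moebius α β γ δ z ∈ basin q'.toMap (moebius α β γ δ p) →
        z ∈ basin q.toMap p := by
      intro z hz
      have := basin_semiconj hc' hsemi' hz
      rwa [hl, hl] at this
    rintro (h1 | h1)
    · exact Or.inl fun z hz => key z (h1 ((moebius_mem_realCircle_iff hΔ).2 hz))
    · exact Or.inr fun z hz => key z (h1 (mt (moebius_mem_realCircle_iff hΔ).1 hz))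

end Conjugation

/-! ### The nonescaping set and the three normal forms -/

/-- The finite points that do not escape to `∞`. -/
def nonescaping (q : QuadPair) : Set ℂ := {z | (z : Sphere) ∉ basin q.toMap OnePoint.infty}

variable {q : QuadPair}

lemma Escapes.infty_mem_basin (h : q.Escapes OnePoint.infty) :
    OnePoint.infty ∈ basin q.toMap OnePoint.infty := by
  have : ∀ n : ℕ, q.toMap^[n] OnePoint.infty = OnePoint.infty := fun n =>
    Function.iterate_fixed h.fixed n
  simp only [basin, Set.mem_ofPred_eq, this]
  exact tendsto_const_nhds

lemma Escapes.isCompact_nonescaping (h : q.Escapes OnePoint.infty) : IsCompact q.nonescaping :=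
  ((OnePoint.isOpen_iff_of_mem h.infty_mem_basin).1
    (isOpen_basin (continuous_toMap h.isReduced) h.attracting)).2

lemma Escapes.dichotomy_of_nonescaping (h : q.Escapes OnePoint.infty)
    (hK : (∀ x : ℝ, (x : ℂ) ∉ q.nonescaping) ∨ ∀ z ∈ q.nonescaping, z.im = 0) :
    BasinDichotomy q.toMap OnePoint.infty := by
  rcases hK with hK | hK
  · left
    rintro _ (rfl | ⟨x, rfl⟩)
    · exact h.infty_mem_basin
    · exact not_not.1 (hK x)
  · right
    intro z hz
    induction z using OnePoint.rec with
    | infty => exact h.infty_mem_basin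
    | coe z =>
      by_contra hcon
      refine hz (Or.inr ⟨z.re, ?_⟩)
      exact congrArg _ (ofReal_re_eq (hK z hcon))

/-- The image of the interval is closed, invariant and misses `∞`, so no orbit in it can converge to
`∞`. -/
lemma coe_mem_nonescaping_of_mapsTo {a b : ℝ} {r : ℝ → ℝ}
    (hr : ∀ x ∈ Set.Icc a b, q.toMap (((x : ℝ) : ℂ) : Sphere) = (((r x : ℝ) : ℂ) : Sphere))
    (hinv : ∀ x ∈ Set.Icc a b, r x ∈ Set.Icc a b) {x : ℝ} (hx : x ∈ Set.Icc a b) :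
    (x : ℂ) ∈ q.nonescaping := by
  intro hb
  set S : Set Sphere := (fun x : ℝ => (((x : ℝ) : ℂ) : Sphere)) '' Set.Icc a b with hS
  have hcl : IsClosed S :=
    (isCompact_Icc.image (OnePoint.continuous_coe.comp Complex.continuous_ofReal)).isClosed
  have hmaps : Set.MapsTo q.toMap S S := by
    rintro _ ⟨y, hy, rfl⟩
    exact ⟨r y, hinv y hy, (hr y hy).symm⟩
  obtain ⟨y, -, hy⟩ := hcl.mem_of_tendsto hb
    (Eventually.of_forall fun n => hmaps.iterate n ⟨x, hx, rfl⟩)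
  exact OnePoint.coe_ne_infty _ hy

lemma Escapes.notMem_nonescaping (h : q.Escapes OnePoint.infty) {z : ℂ} (hz : q.jac z 1 = 0) :
    z ∉ q.nonescaping := by
  have := h.critical z 1 (by simp) hz
  rw [homog_one] at this
  exact not_not.2 this

lemma mem_nonescaping_of_apply {z w : ℂ} (h : q.toMap (z : Sphere) = (w : Sphere)) :
    w ∈ q.nonescaping ↔ z ∈ q.nonescaping := by
  simp only [nonescaping, Set.mem_ofPred_eq, ← h]
  exact not_congr mem_basin_apply_iff

lemma dichotomy_polynomial {c : ℝ} (h : (QuadPair.mk 1 0 c 0 0 1).Escapes OnePoint.infty) :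
    BasinDichotomy (QuadPair.mk 1 0 c 0 0 1).toMap OnePoint.infty := by
  have happ : ∀ z : ℂ, (QuadPair.mk 1 0 c 0 0 1).toMap (z : Sphere) =
      ((z ^ 2 + c : ℂ) : Sphere) := by
    intro z
    rw [toMap_coe, ← homog_one]
    simp [num, den]
  refine h.dichotomy_of_nonescaping (polynomial_dichotomy h.isCompact_nonescaping
    (fun z => mem_nonescaping_of_apply (happ z)) (fun a b hab x hx => ?_)
    (h.notMem_nonescaping (by simp [jac])))
  exact coe_mem_nonescaping_of_mapsTo (r := fun x => x ^ 2 + c)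
    (fun y _ => by rw [happ]; push_cast; rfl) hab hx

lemma toMap_simplePole {A B C : ℝ} {z : ℂ} (hz : z ≠ 0) :
    (QuadPair.mk A B C 0 1 0).toMap (z : Sphere) = ((A * z + C * z⁻¹ + B : ℂ) : Sphere) := by
  have hd : (QuadPair.mk A B C 0 1 0).den z 1 = z := by simp [den]
  rw [toMap_coe, homog_of_ne _ (by rwa [hd]), hd, OnePoint.coe_eq_coe]
  simp only [num]
  field_simp
  ring

lemma Escapes.zero_notMem {A B C : ℝ} (h : (QuadPair.mk A B C 0 1 0).Escapes OnePoint.infty) :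
    (0 : ℂ) ∉ (QuadPair.mk A B C 0 1 0).nonescaping := by
  have h0 : (QuadPair.mk A B C 0 1 0).toMap ((0 : ℂ) : Sphere) = OnePoint.infty := by
    rw [toMap_coe]
    simp [den, homog]
  refine not_not.2 ?_
  rw [← mem_basin_apply_iff, h0]
  exact h.infty_mem_basin

lemma dichotomy_joukowski {A B : ℝ} (hA : 1 < |A|)
    (h : (QuadPair.mk A B A 0 1 0).Escapes OnePoint.infty) :
    BasinDichotomy (QuadPair.mk A B A 0 1 0).toMap OnePoint.infty := by
  have happ : ∀ z : ℂ, z ≠ 0 → (QuadPair.mk A B A 0 1 0).toMap (z : Sphere) =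
      (joukowski A B z : Sphere) := by
    intro z hz
    rw [toMap_simplePole hz, joukowski, mul_add]
  refine h.dichotomy_of_nonescaping (IsTrapped.dichotomy (A := A) (B := B)
    ⟨h.isCompact_nonescaping, h.zero_notMem, fun z hz => mem_nonescaping_of_apply (happ z hz),
      fun a b hab hinv x hx => ?_, h.notMem_nonescaping (by simp [jac]),
      h.notMem_nonescaping (by simp [jac])⟩ hA)
  refine coe_mem_nonescaping_of_mapsTo (r := realJoukowski A B) (fun y hy => ?_) hinv hx
  have hy0 : y ≠ 0 := by
    rintro rfl
    rcases hab with hab | hab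
    · exact absurd hy.1 (not_le.2 hab)
    · exact absurd hy.2 (not_le.2 hab)
  rw [happ _ (by exact_mod_cast hy0), joukowski_ofReal]

/-- The map multiplies `|im w|` by `|A| (1 + 1 / |w| ^ 2) > 1`, so a point of the compact
nonescaping set maximising `|im w|` must be real. -/
lemma dichotomy_nonreal_critical {A B : ℝ} (hA : 1 < |A|)
    (h : (QuadPair.mk A B (-A) 0 1 0).Escapes OnePoint.infty) :
    BasinDichotomy (QuadPair.mk A B (-A) 0 1 0).toMap OnePoint.infty := by
  refine h.dichotomy_of_nonescaping (Or.inr fun z hz => ?_)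
  obtain ⟨w, hw, hmax⟩ := h.isCompact_nonescaping.exists_isMaxOn (f := fun z => |z.im|) ⟨z, hz⟩
    (by fun_prop)
  have hw0 : w ≠ 0 := fun h0 => h.zero_notMem (h0 ▸ hw)
  have hle := hmax ((mem_nonescaping_of_apply (toMap_simplePole hw0)).2 hw)
  have him : ((A * w + ((-A : ℝ) : ℂ) * w⁻¹ + B : ℂ)).im =
      A * (w.im * (1 + (Complex.normSq w)⁻¹)) := by
    simp [Complex.inv_im]; ring
  have hn : 0 < (Complex.normSq w)⁻¹ := inv_pos.2 (Complex.normSq_pos.2 hw0)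
  simp only [Set.mem_ofPred_eq, him, abs_mul] at hle
  rw [abs_of_pos (by linarith : 0 < 1 + (Complex.normSq w)⁻¹)] at hle
  have hw1 : |w.im| = 0 := by
    by_contra hne
    have hpos : 0 < |w.im| := lt_of_le_of_ne (abs_nonneg _) (Ne.symm hne)
    have h1 : |w.im| ≤ |w.im| * (1 + (Complex.normSq w)⁻¹) := by nlinarith
    nlinarith
  have h2 : |z.im| ≤ |w.im| := hmax hz
  rw [hw1] at h2
  exact abs_eq_zero.1 (le_antisymm h2 (abs_nonneg _))

lemma moebius_affine_infty {α β δ : ℝ} : moebius α β 0 δ OnePoint.infty = OnePoint.infty := by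
  rw [moebius_infty, Complex.ofReal_zero, homog_zero]

/-! ### Reduction to the normal forms -/

/-- The dichotomy for a map with attracting fixed point `∞`. -/
lemma Escapes.dichotomy_infty (h : q.Escapes OnePoint.infty) (hd : q.d = 0)
    (hea : |q.e| < |q.a|) : BasinDichotomy q.toMap OnePoint.infty := by
  obtain ⟨a, b, c, d, e, g⟩ := q
  simp only at hd hea
  subst hd
  have ha : a ≠ 0 := abs_pos.1 ((abs_nonneg _).trans_lt hea)
  have hac : (a : ℂ) ≠ 0 := by exact_mod_cast ha
  by_cases he : e = 0
  · subst he
    have hg : g ≠ 0 := by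
      rintro rfl
      obtain ⟨x, hx⟩ : ∃ x : ℂ, (QuadPair.mk a b c 0 0 0).num x 1 = 0 := by
        obtain ⟨s, hs⟩ := IsAlgClosed.exists_eq_mul_self (discrim (a : ℂ) b c)
        obtain ⟨x, hx⟩ := exists_quadratic_eq_zero hac ⟨s, hs⟩
        exact ⟨x, by rw [← hx]; simp only [num]; ring⟩
      rcases h.isReduced x 1 (by simp) with h1 | h1
      · exact h1 hx
      · exact h1 (by simp [den])
    have hgc : (g : ℂ) ≠ 0 := by exact_mod_cast hg
    -- With constant denominator `g` the map is a polynomial; the coordinate `(a / g) z + b / (2 g)`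
    -- makes it monic and completes the square.
    obtain ⟨h1, h2⟩ := h.conjugate (q' := ⟨1, 0, (a * c - b ^ 2 / 4) / g ^ 2 + b / (2 * g), 0, 0, 1⟩)
      (α := a / g) (β := b / (2 * g)) (γ := 0) (δ := 1) (κ := g) hg
      (by simp [ha, hg])
      (by intro x y; simp only [num, den]; push_cast; field_simp; ring)
      (by intro x y; simp only [num, den]; push_cast; field_simp; ring)
      (by
        intro x y hxy
        have e1 : (QuadPair.mk a b c 0 0 g).jac x y =
            (g : ℂ) ^ 2 * (QuadPair.mk 1 0 ((a * c - b ^ 2 / 4) / g ^ 2 + b / (2 * g)) 0 0 1).jac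
              (((a / g : ℝ) : ℂ) * x + ((b / (2 * g) : ℝ) : ℂ) * y)
              (((0 : ℝ) : ℂ) * x + ((1 : ℝ) : ℂ) * y) := by
          simp only [jac]; push_cast; field_simp; ring
        rw [e1, hxy, mul_zero])
    rw [moebius_affine_infty] at h1 h2
    exact h2 (dichotomy_polynomial h1)
  · have hec : (e : ℂ) ≠ 0 := by exact_mod_cast he
    have hA : 1 < |a / e| := by rw [abs_div, lt_div_iff₀ (abs_pos.2 he), one_mul]; exact hea
    -- In the coordinate `w = z + g / e` the pole is `0` and the map is `(a / e) (w + R / w)` plus a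
    -- constant, with critical points `± √R`. Scaling by `√|R|` leaves only the sign `k` of `R`.
    set R := (a * g ^ 2 / e ^ 2 - b * g / e + c) / a with hR
    have hR0 : R ≠ 0 := by
      intro hR0
      have hR1 : a * g ^ 2 / e ^ 2 - b * g / e + c = 0 := by
        rw [hR, div_eq_zero_iff] at hR0
        exact hR0.resolve_right ha
      have hR2 : (a * g ^ 2 / e ^ 2 - b * g / e + c : ℂ) = 0 := by exact_mod_cast hR1
      rcases h.isReduced (-g / e) 1 (by simp) with h1 | h1
      · refine h1 (Eq.trans ?_ hR2)
        simp only [num]; field_simp; ring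
      · refine h1 ?_
        simp only [den]; push_cast; field_simp; ring
    obtain ⟨k, hk, hσ⟩ : ∃ k : ℝ, (k = 1 ∨ k = -1) ∧ k * √|R| ^ 2 = R := by
      rw [Real.sq_sqrt (abs_nonneg _)]
      rcases abs_cases R with ⟨h1, -⟩ | ⟨h1, -⟩
      · exact ⟨1, Or.inl rfl, by rw [h1]; ring⟩
      · exact ⟨-1, Or.inr rfl, by rw [h1]; ring⟩
    have hσ0 : √|R| ≠ 0 := (Real.sqrt_pos.2 (abs_pos.2 hR0)).ne'
    set σ := √|R|
    have hσc : (σ : ℂ) ≠ 0 := by exact_mod_cast hσ0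
    have hrel : (k * σ ^ 2 * a * e ^ 2 : ℂ) = a * g ^ 2 - b * g * e + c * e ^ 2 := by
      have : k * σ ^ 2 * a * e ^ 2 = a * g ^ 2 - b * g * e + c * e ^ 2 := by
        rw [hσ, hR]; field_simp
      exact_mod_cast this
    obtain ⟨h1, h2⟩ := h.conjugate
      (q' := ⟨a / e, ((b - 2 * a * g / e) / e + g / e) / σ, a / e * k, 0, 1, 0⟩)
      (α := e) (β := g) (γ := 0) (δ := e * σ) (κ := 1) one_ne_zero
      (by simp [he, hσ0])
      (by
        intro x y; simp only [num, den]; push_cast; field_simp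
        linear_combination e * σ * y ^ 2 * hrel)
      (by intro x y; simp only [num, den]; push_cast; ring)
      (by
        intro x y hxy
        rw [← hxy]
        simp only [jac]; push_cast; field_simp
        linear_combination e * σ * y ^ 2 * hrel)
    rw [moebius_affine_infty] at h1 h2
    refine h2 ?_
    rcases hk with rfl | rfl
    · rw [mul_one] at h1 ⊢
      exact dichotomy_joukowski hA h1
    · rw [mul_neg_one] at h1 ⊢
      exact dichotomy_nonreal_critical hA h1

/-- The dichotomy for a map with a finite real attracting fixed point. -/
lemma Escapes.dichotomy_coe {r : ℝ} (h : q.Escapes ((r : ℂ) : Sphere))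
    (hatt : IsAttractingFixedPoint q.toMap ((r : ℂ) : Sphere)) :
    BasinDichotomy q.toMap ((r : ℂ) : Sphere) := by
  obtain ⟨hfix, hden, hjac⟩ := norm_jac_lt_of_attracting_coe hatt
  obtain ⟨a, b, c, d, e, g⟩ := q
  have hfixc : (a * r ^ 2 + b * r + c : ℂ) = (d * r ^ 2 + e * r + g) * r := by
    simpa [num, den] using hfix
  have hdr : (QuadPair.mk a b c d e g).den r 1 = ((d * r ^ 2 + e * r + g : ℝ) : ℂ) := by
    simp only [den]; push_cast; ring
  have hjr : (QuadPair.mk a b c d e g).jac r 1 =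
      (((2 * a * r + b - r * (2 * d * r + e)) * (d * r ^ 2 + e * r + g) : ℝ) : ℂ) := by
    simp only [jac]; push_cast
    linear_combination (-(2 * d * r + e : ℂ)) * hfixc
  rw [hdr] at hden
  have hD : d * r ^ 2 + e * r + g ≠ 0 := by exact_mod_cast hden
  rw [hjr, hdr, Complex.norm_real, Complex.norm_real, Real.norm_eq_abs, Real.norm_eq_abs, abs_mul,
    pow_two |d * r ^ 2 + e * r + g|] at hjac
  have hlt := lt_of_mul_lt_mul_right hjac (abs_nonneg _)
  -- The coordinate `1 / (z - r)` sends `r` to `∞`. In the new pair the ratio of the `e` coefficient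
  -- to the `a` coefficient is the multiplier at `r`, so `hlt` is the bound needed at `∞`.
  obtain ⟨h1, h2⟩ := h.conjugate
    (q' := ⟨d * r ^ 2 + e * r + g, 2 * d * r + e, d, 0, 2 * a * r + b - r * (2 * d * r + e),
      a - r * d⟩)
    (α := 0) (β := 1) (γ := 1) (δ := -r) (κ := 1) one_ne_zero (by norm_num)
    (by intro x y; simp only [num, den]; push_cast; ring)
    (by
      intro x y; simp only [num, den]; push_cast
      linear_combination (-y ^ 2) * hfixc)
    (by
      intro x y hxy
      rw [← hxy]
      simp only [jac]; push_cast
      linear_combination (-(e * y ^ 2 + 2 * d * x * y)) * hfixc)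
  have hm : moebius 0 1 1 (-r) ((r : ℂ) : Sphere) = OnePoint.infty := by
    rw [← homog_one, moebius_homog (by simp)]
    simp [homog]
  rw [hm] at h1 h2
  exact h2 (h1.dichotomy_infty rfl hlt)

lemma dichotomy (hq : q.IsReduced) {p : Sphere} (hatt : IsAttractingFixedPoint q.toMap p)
    (hcrit : q.CriticalInBasin p) : BasinDichotomy q.toMap p := by
  have h : q.Escapes p := ⟨hq, hatt.1,
    hatt.uniformlyAttracting (continuous_toMap hq).continuousAt, hcrit⟩
  rcases hcrit.mem_realCircle with rfl | ⟨r, rfl⟩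
  · obtain ⟨hd, hea⟩ := abs_lt_of_attracting_infty hq hatt
    exact h.dichotomy_infty hd hea
  · exact h.dichotomy_coe hatt

end QuadPair

end RatDyn

end

theorem mainTheorem6 (f : RatFunc ℝ) (hdeg : RatDyn.degree f = 2)
    (hesc : RatDyn.InEscapeLocus (RatDyn.sphereMap f)) :
    RatDyn.juliaSet (RatDyn.sphereMap f) ⊆ RatDyn.realCircle ∨
      Disjoint (RatDyn.juliaSet (RatDyn.sphereMap f)) RatDyn.realCircle := by
  have hq := RatDyn.quadPair_isReduced hdeg
  rw [RatDyn.sphereMap_eq_toMap hdeg] at hesc ⊢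
  obtain ⟨p, hatt, hcrit⟩ := hesc
  have hfatou := RatDyn.basin_subset_fatouSet (RatDyn.QuadPair.continuous_toMap hq)
    (hatt.uniformlyAttracting (RatDyn.QuadPair.continuous_toMap hq).continuousAt)
  rcases RatDyn.QuadPair.dichotomy hq hatt fun x y hxy hj =>
    hcrit _ (RatDyn.QuadPair.isCriticalPoint_homog hq hxy hj) with h | h
  · exact Or.inr (Set.disjoint_left.2 fun z hz hzr => hz (hfatou (h hzr)))
  · left
    intro z hz
    by_contra hzr
    exact hz (hfatou (h hzr))
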